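/- **Setting.** Let $F$ be a locally compact Hausdorff space with a countable base, $d\in\mathbb N$, and $E=[0,\infty)\times\mathbb R^d\times F$. Let $D_E$ be the space of right-continuous paths $\omega:[0,\infty)\to E$ with left limits, with the Borel $\sigma$-algebra of the Skorokhod topology (generated by the coordinate maps), and let $X_t=(T_t,S_t,\eta_t)$ be the coordinate process, with $T,S,\eta$ taking values in $[0,\infty)$, $\mathbb R^d$ and $F$. Let $\mathbb F^0=(\mathcal F^0_t)_{t\ge0}$ be the raw filtration generated by $X$, $\mathcal F_t=\bigcap_{s>t}\mathcal F^0_s$, and $\mathbb F=(\mathcal F_t)_{t\ge 0}$. Let $\mathcal T$ be the set of all bounded $\mathbb F$-stopping times $\tau:D_E\to[0,\infty)$, and let $\theta_r\omega=\omega(r+\cdot)$ be the shifts. Let $x\mapsto\mathbb P^x$ be a Borel-measurable map from $E$ to the probability measures on $D_E$ such that: 1. (strong Markov family) $\mathbb P^x[X_0=x]=1$ and $\mathbb E^x[Z\circ\theta_\tau\mid\mathcal F_\tau]=\mathbb E^{X_\tau}[Z]$, $\mathbb P^x$-a.s., for all $x\in E$, $\tau\in\mathcal T$ and bounded Borel $Z:D_E\to\mathbb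 R$; 2. (finite horizon) for all $x\in E$, $\mathbb P^x$-a.s., $T_t=T_0-t$ for all $t\le T_0$; and for $x\in\{0\}\times\mathbb R^d\times F$, $\mathbb P^x$ is the Dirac mass at the constant path $x$; 3. (no arbitrage) $\mathcal M^x\neq\emptyset$ for all $x\in E$, where $\mathcal M^x$ is the set of all probability measures $\mathbb Q$ on $D_E$ that are equivalent to $\mathbb P^x$ and under which $S$ is a local martingale for the filtration $\mathbb F^0$; 4. (uniform local boundedness from below) for each $n\in\mathbb N$ there is a constant $a_n\in\mathbb R$ such that for all $x\in E$, $\mathbb P^x$-a.s. on $\{\tau_n>0\}$, all coordinates of $S_{t\wedge\tau_n}$ are at least $a_n$ for all $t\ge0$, where $\tau_n=\inf\{t\ge0:|S_t|\ge n\}$. A *selector* of $\mathcal M$ is a family $\nu=(\nu_x)_{x\in E}$ of probability measures on $D_E$ with $\nu_x\in\mathcal M^x$ for all $x$ such that $x\mapsto\nu_x(A)$ is universally measurable for every Borel set $A\subseteq D_E$. For $\omega,\omega'\in D_E$ let $\omega*_\tau\omega'$ be the path equal to $\omega(t)$ for $t<\tau(\omega)$ and to $\omega'(t-\tau(\omega))$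 for $t\ge\tau(\omega)$. For a probability measure $\mathbb Q$ on $D_E$, $\tau\in\mathcal T$ and a selector $\nu$, the concatenation $\mathbb Q*_\tau\nu$ is the probability measure $$(\mathbb Q*_\tau\nu)[A]=\iint \mathbf 1_A(\omega*_\tau\omega')\,\nu_{X_\tau(\omega)}(d\omega')\,\mathbb Q(d\omega),\qquad A\subseteq D_E\text{ Borel}.$$ **Proposition.** For all $x\in E$, $\mathbb Q\in\mathcal M^x$, $\tau\in\mathcal T$ and every selector $\nu$ of $\mathcal M$, one has $\mathbb Q*_\tau\nu\in\mathcal M^x$. -/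

import Mathlib

open MeasureTheory ProbabilityTheory Filter Topology Set
open scoped NNReal

/-! ### Right-continuous paths with left limits -/

/-- `f : [0,∞) → E` is right-continuous with left limits. (At `t = 0` the left-limit clause is
trivial, because `𝓝[<] 0 = ⊥` in `ℝ≥0`.) -/
def IsRCLL {E : Type*} [TopologicalSpace E] (f : ℝ≥0 → E) : Prop :=
  ∀ t : ℝ≥0, ContinuousWithinAt f (Ici t) t ∧ ∃ l : E, Tendsto f (𝓝[<] t) (𝓝 l)

/-- The space `D_E` of `E`-valued RCLL paths on `[0,∞)`. As a subtype of `ℝ≥0 → E` it carries the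
σ-algebra generated by the coordinate maps; for Polish `E` this is the Borel σ-algebra of the
Skorokhod topology. -/
abbrev PathSpace (E : Type*) [TopologicalSpace E] : Type _ := {ω : ℝ≥0 → E // IsRCLL ω}

theorem isRCLL_const {E : Type*} [TopologicalSpace E] (x : E) : IsRCLL (fun _ : ℝ≥0 => x) :=
  fun _ => ⟨continuousWithinAt_const, x, tendsto_const_nhds⟩

theorem isRCLL_shift {E : Type*} [TopologicalSpace E] {f : ℝ≥0 → E} (hf : IsRCLL f) (r : ℝ≥0) :
    IsRCLL (fun t => f (r + t)) := by
  intro t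
  have hc : Continuous (fun s : ℝ≥0 => r + s) := by fun_prop
  refine ⟨?_, ?_⟩
  · exact ContinuousWithinAt.comp (t := Ici (r + t)) (hf (r + t)).1 hc.continuousWithinAt
      (fun s hs => add_le_add_right (mem_Ici.1 hs) r)
  · obtain ⟨l, hl⟩ := (hf (r + t)).2
    refine ⟨l, hl.comp ?_⟩
    exact tendsto_nhdsWithin_of_tendsto_nhds_of_eventually_within _
      (hc.continuousAt.tendsto.mono_left nhdsWithin_le_nhds)
      (eventually_mem_nhdsWithin.mono fun s hs => add_lt_add_right (mem_Iio.1 hs) r)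

theorem isRCLL_paste {E : Type*} [TopologicalSpace E] {f g : ℝ≥0 → E} (hf : IsRCLL f)
    (hg : IsRCLL g) (r : ℝ≥0) : IsRCLL (fun t => if t < r then f t else g (t - r)) := by
  have hc : Continuous (fun s : ℝ≥0 => s - r) := by fun_prop
  intro t
  refine ⟨?_, ?_⟩
  · rcases lt_or_ge t r with h | h
    · refine (hf t).1.congr_of_eventuallyEq ?_ (by simp [h])
      filter_upwards [mem_nhdsWithin_of_mem_nhds (Iio_mem_nhds h)] with s hs
      simp [mem_Iio.1 hs]
    · have h1 : ContinuousWithinAt (fun s => g (s - r)) (Ici t) t :=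
        ContinuousWithinAt.comp (t := Ici (t - r)) (hg (t - r)).1 hc.continuousWithinAt
          (fun s hs => tsub_le_tsub_right (mem_Ici.1 hs) r)
      refine h1.congr (fun s hs => ?_) ?_
      · simp [not_lt.2 (h.trans (mem_Ici.1 hs))]
      · simp [not_lt.2 h]
  · rcases le_or_gt t r with h | h
    · obtain ⟨l, hl⟩ := (hf t).2
      refine ⟨l, hl.congr' ?_⟩
      filter_upwards [self_mem_nhdsWithin] with s hs
      simp [(mem_Iio.1 hs).trans_le h]
    · obtain ⟨l, hl⟩ := (hg (t - r)).2
      refine ⟨l, Tendsto.congr' (f₁ := fun s => g (s - r)) ?_ (hl.comp ?_)⟩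
      · filter_upwards [mem_nhdsWithin_of_mem_nhds (Ioi_mem_nhds h)] with s hs
        simp [not_lt.2 (mem_Ioi.1 hs).le]
      · refine tendsto_nhdsWithin_of_tendsto_nhds_of_eventually_within _
          (hc.continuousAt.tendsto.mono_left nhdsWithin_le_nhds) ?_
        filter_upwards [self_mem_nhdsWithin, mem_nhdsWithin_of_mem_nhds (Ioi_mem_nhds h)]
          with s hs hs'
        exact tsub_lt_tsub_right_of_le (mem_Ioi.1 hs').le (mem_Iio.1 hs)

/-- The path with constant value `x`. -/
def constPath {E : Type*} [TopologicalSpace E] (x : E) : PathSpace E :=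
  ⟨fun _ => x, isRCLL_const x⟩

/-- The shift `θ_r ω = ω(r + ·)`. -/
def shiftPath {E : Type*} [TopologicalSpace E] (r : ℝ≥0) (ω : PathSpace E) : PathSpace E :=
  ⟨fun t => ω.1 (r + t), isRCLL_shift ω.2 r⟩

/-- The concatenation of `ω` and `ω'` at time `r`: follow `ω` on `[0,r)`, and from time `r` on
follow `ω'`, restarted at time `r`. (It is used for `ω'` with `ω' 0 = ω r`, where the correction
`ω r - ω' 0` that glues the two paths is zero; the state space has no addition in general.) -/
noncomputable def concatPath {E : Type*} [TopologicalSpace E] (r : ℝ≥0) (ω ω' : PathSpace E) :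
    PathSpace E :=
  ⟨fun t => if t < r then ω.1 t else ω'.1 (t - r), isRCLL_paste ω.2 ω'.2 r⟩

/-! ### Filtrations and stopping times -/

/-- The raw filtration generated by the coordinate process. -/
def rawFiltration (E : Type*) [TopologicalSpace E] [MeasurableSpace E] :
    Filtration ℝ≥0 (inferInstance : MeasurableSpace (PathSpace E)) where
  seq t := ⨆ s ≤ t, MeasurableSpace.comap (fun ω : PathSpace E => ω.1 s) inferInstance
  mono' _ _ hst := biSup_mono fun _ h => h.trans hst
  le' _ := iSup₂_le fun s _ => ((measurable_pi_apply s).comp measurable_subtype_coe).comap_le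

/-- The right-continuous hull of the raw filtration. -/
noncomputable def hullFiltration (E : Type*) [TopologicalSpace E] [MeasurableSpace E] :
    Filtration ℝ≥0 (inferInstance : MeasurableSpace (PathSpace E)) :=
  (rawFiltration E).rightCont

/-- `τ` is a stopping time of the right-continuous hull of the raw filtration. -/
def IsHullStoppingTime {E : Type*} [TopologicalSpace E] [MeasurableSpace E]
    (τ : PathSpace E → ℝ≥0) : Prop :=
  IsStoppingTime (hullFiltration E) (fun ω => (τ ω : WithTop ℝ≥0))

/-- `τ` is bounded by a deterministic constant. -/
def IsBoundedTime {E : Type*} [TopologicalSpace E] (τ : PathSpace E → ℝ≥0) : Prop :=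
  ∃ C : ℝ≥0, ∀ ω, τ ω ≤ C

/-! ### Universally measurable kernels and concatenation of laws -/

/-- The universal σ-algebra: the intersection, over all probability measures `μ`, of the
`μ`-completions of the given σ-algebra. -/
@[reducible]
def universalMeasurableSpace (E : Type*) [MeasurableSpace E] : MeasurableSpace E where
  MeasurableSet' s := ∀ μ : Measure E, IsProbabilityMeasure μ → NullMeasurableSet s μ
  measurableSet_empty _ _ := nullMeasurableSet_empty
  measurableSet_compl _ h μ hμ := (h μ hμ).compl
  measurableSet_iUnion _ h μ hμ := NullMeasurableSet.iUnion fun n => h n μ hμ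

/-- A universally measurable kernel from `E` to the path space over `E`. -/
structure IsUniversalKernel {E : Type*} [TopologicalSpace E] [MeasurableSpace E]
    (ν : E → Measure (PathSpace E)) : Prop where
  isProbabilityMeasure : ∀ x, IsProbabilityMeasure (ν x)
  measurable_apply : ∀ A : Set (PathSpace E), MeasurableSet A →
    Measurable[universalMeasurableSpace E] (fun x => ν x A)

/-- `ν` is a universally measurable selector of the family `M` of sets of laws. -/
structure IsSelector {E : Type*} [TopologicalSpace E] [MeasurableSpace E]
    (M : E → Set (Measure (PathSpace E))) (ν : E → Measure (PathSpace E)) : Prop where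
  isUniversalKernel : IsUniversalKernel ν
  mem : ∀ x, ν x ∈ M x

/-- The product `μ ⊗_τ ν`, that is `B ↦ ∬ 1_B(ω, ω') ν_{X_τ(ω)}(dω') μ(dω)`. -/
noncomputable def productLaw {E : Type*} [TopologicalSpace E] [MeasurableSpace E]
    (μ : Measure (PathSpace E)) (τ : PathSpace E → ℝ≥0) (ν : E → Measure (PathSpace E)) :
    Measure (PathSpace E × PathSpace E) :=
  μ.bind fun ω => (ν (ω.1 (τ ω))).map fun ω' => (ω, ω')

/-- The concatenation `μ *_τ ν`: the image of `μ ⊗_τ ν` under the concatenation of paths. -/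
noncomputable def concatLaw {E : Type*} [TopologicalSpace E] [MeasurableSpace E]
    (μ : Measure (PathSpace E)) (τ : PathSpace E → ℝ≥0) (ν : E → Measure (PathSpace E)) :
    Measure (PathSpace E) :=
  (productLaw μ τ ν).map fun p => concatPath (τ p.1) p.1 p.2

/-! ### Canonical strong Markov families -/

/-- `(P x)` starts at `x` and has the strong Markov property at all bounded stopping times of the
right-continuous hull of the raw filtration. (Borel measurability of `x ↦ P x` is part of `P`
being a `Kernel`.) -/
structure IsStrongMarkovFamily {E : Type*} [TopologicalSpace E] [MeasurableSpace E]
    (P : Kernel E (PathSpace E)) : Prop where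
  start : ∀ x, P x {ω | ω.1 0 = x} = 1
  strongMarkov : ∀ (τ : PathSpace E → ℝ≥0) (hτ : IsHullStoppingTime τ), IsBoundedTime τ →
    ∀ (x : E) (Z : PathSpace E → ℝ), Measurable Z → (∃ C : ℝ, ∀ ω, |Z ω| ≤ C) →
      (P x)[fun ω => Z (shiftPath (τ ω) ω) | IsStoppingTime.measurableSpace hτ]
        =ᵐ[P x] fun ω => ∫ ω', Z ω' ∂(P (ω.1 (τ ω)))

/-! ### The financial market model -/

/-- The state space `[0,∞) × ℝ^d × F`: time to go, asset prices, external factor. -/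
abbrev MarketState (d : ℕ) (F : Type*) : Type _ := ℝ≥0 × EuclideanSpace ℝ (Fin d) × F

/-- The asset-price process `S`, the middle component of the coordinate process. -/
def priceProcess (d : ℕ) (F : Type*) [TopologicalSpace F] :
    ℝ≥0 → PathSpace (MarketState d F) → EuclideanSpace ℝ (Fin d) :=
  fun t ω => (ω.1 t).2.1

/-- `τ_n = inf {t ≥ 0 : |S_t| ≥ n}`, with `inf ∅ = ⊤`. -/
noncomputable def exitTime (d : ℕ) (F : Type*) [TopologicalSpace F] (n : ℕ) :
    PathSpace (MarketState d F) → WithTop ℝ≥0 :=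
  hittingAfter (priceProcess d F) {s | (n : ℝ) ≤ ‖s‖} 0

/-- The set `M^x` of equivalent local-martingale measures: probability measures `Q ∼ P^x` under
which `S` is a local martingale for the raw filtration. -/
def localMartingaleMeasures {d : ℕ} {F : Type*} [TopologicalSpace F] [MeasurableSpace F]
    (P : Kernel (MarketState d F) (PathSpace (MarketState d F))) (x : MarketState d F) :
    Set (Measure (PathSpace (MarketState d F))) :=
  {Q | IsProbabilityMeasure Q ∧ (Q ≪ P x ∧ P x ≪ Q) ∧
    Locally (fun Y => Martingale Y (rawFiltration (MarketState d F)) Q)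
      (rawFiltration (MarketState d F)) (priceProcess d F) Q}

/-- Finite horizon: the time to go decreases at unit speed until it is zero, and states with zero
time to go are absorbing. -/
structure HasFiniteHorizon {d : ℕ} {F : Type*} [TopologicalSpace F] [MeasurableSpace F]
    (P : Kernel (MarketState d F) (PathSpace (MarketState d F))) : Prop where
  timeToGo : ∀ x, ∀ᵐ ω ∂(P x), ∀ t : ℝ≥0, t ≤ (ω.1 0).1 → (ω.1 t).1 = (ω.1 0).1 - t
  absorbing : ∀ x : MarketState d F, x.1 = 0 → P x = Measure.dirac (constPath x)

/-- Uniform local boundedness from below: for each `n` the stopped process `S^{τ_n}` is bounded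
from below, coordinatewise, by a constant that does not depend on the initial state, on the event
`{τ_n > 0}` (off this event the stopped process is constantly equal to `S_0`, and no bound uniform
in the initial state is possible). -/
def UniformlyLocallyBoundedBelow {d : ℕ} {F : Type*} [TopologicalSpace F] [MeasurableSpace F]
    (P : Kernel (MarketState d F) (PathSpace (MarketState d F))) : Prop :=
  ∀ n : ℕ, ∃ a : ℝ, ∀ x, ∀ᵐ ω ∂(P x), 0 < exitTime d F n ω →
    ∀ (t : ℝ≥0) (i : Fin d), a ≤ stoppedProcess (priceProcess d F) (exitTime d F n) t ω i

/-! Equivalence and the local martingale property are proved separately. For the former, the strong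
Markov property disintegrates `P x` at `τ`: a path under `P x` is its own past followed by an
independent continuation with law `P (X_τ)`, given the past
(`IsStrongMarkovFamily.measure_eq_lintegral_concatPath`). The concatenation has the same structure,
with the equivalent laws `Q` and `ν (X_τ)` in place of `P x` and `P (X_τ)`, so the null sets agree.

For the latter, one path-defined localizing sequence serves all laws: the times `ρ_n` at which the
running supremum of `|S|` reaches `n`. Unlike the hitting time of `{|S| ≥ n}`, the running supremum
is read off countably many coordinates, so `ρ_n` is a stopping time of the raw filtration. Let `Y`
be a coordinate of `S` stopped at `ρ_n`, set to zero if `ρ_n = 0`. It starts below `n` and, almost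
surely, is bounded below by a constant. Fatou gives integrability, domination by `n + |Y_t|` turns
the local martingale into a martingale, and `E|Y_t|` is bounded uniformly in the initial state and
the law (`martingale_levelStopped`).

If the paths fit at `τ`, then `Y_t(ω * ω') = Y_{t ∧ τ}(ω) + 1_{τ < ρ_n}(ω) (Y_{t-τ}(ω') - Y_0(ω'))`
(`reachStopped_paste`). The uniform bound makes this integrable. Testing an increment from `s` to
`t` against an event of time `s`, the part with `τ ≤ s` vanishes by the martingale property of the
continuation, and the part with `τ > s` by optional stopping under `Q`
(`martingale_levelStopped_concat`). Universal measurability of `ν` is handled by a Borel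
modification (`IsUniversalKernel.exists_kernel`). -/

/-! ### The first time a path reaches a level -/

section ReachTime

variable {V : Type*} [NormedAddCommGroup V]

/-- The running supremum of `‖f‖` over `[0, t]` is at least `c`. -/
def Reaches (c : ℝ) (f : ℝ≥0 → V) (t : ℝ≥0) : Prop := ∀ m < c, ∃ s ≤ t, m < ‖f s‖

theorem Reaches.mono {c : ℝ} {f : ℝ≥0 → V} {s t : ℝ≥0} (h : Reaches c f s) (hst : s ≤ t) :
    Reaches c f t := fun m hm =>
  let ⟨u, hu, hmu⟩ := h m hm
  ⟨u, hu.trans hst, hmu⟩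

theorem Reaches.antitone_level {c c' : ℝ} {f : ℝ≥0 → V} {t : ℝ≥0} (h : Reaches c' f t)
    (hc : c ≤ c') : Reaches c f t := fun m hm => h m (hm.trans_le hc)

theorem reaches_of_le_norm {c : ℝ} {f : ℝ≥0 → V} {t : ℝ≥0} (h : c ≤ ‖f t‖) : Reaches c f t :=
  fun _ hm => ⟨t, le_rfl, hm.trans_le h⟩

theorem reaches_zero_iff {c : ℝ} {f : ℝ≥0 → V} : Reaches c f 0 ↔ c ≤ ‖f 0‖ := by
  refine ⟨fun h => le_of_forall_lt fun m hm => ?_, reaches_of_le_norm⟩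
  obtain ⟨s, hs, h⟩ := h m hm
  rwa [nonpos_iff_eq_zero.1 hs] at h

/-- A running supremum strictly below `c` leaves room for two levels `m < m' < c`; right-continuity
keeps the path below `m'` for a short while after `t`. -/
theorem exists_gt_not_reaches {c : ℝ} {f : ℝ≥0 → V} {t : ℝ≥0}
    (hf : ContinuousWithinAt f (Ici t) t) (h : ¬ Reaches c f t) : ∃ u > t, ¬ Reaches c f u := by
  simp only [Reaches, not_forall, not_exists, not_and, not_lt] at h
  obtain ⟨m, hm, h⟩ := h
  obtain ⟨m', hm', hm''⟩ := exists_between hm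
  have h1 : ∀ᶠ s in 𝓝[≥] t, ‖f s‖ < m' :=
    hf.norm.eventually (Iio_mem_nhds ((h t le_rfl).trans_lt hm'))
  obtain ⟨u, hu, hu'⟩ := (mem_nhdsGE_iff_exists_Ico_subset).1 h1
  obtain ⟨v, hv, hv'⟩ := exists_between (mem_Ioi.1 hu)
  refine ⟨v, hv, fun hr => ?_⟩
  obtain ⟨s, hs, hs'⟩ := hr m' hm''
  rcases le_total s t with hst | hst
  · exact absurd hs' (not_lt.2 ((h s hst).trans hm'.le))
  · exact absurd hs' (not_lt.2 (hu' ⟨hst, hs.trans_lt hv'⟩).le)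

open Classical in
/-- The first time at which the running supremum of `‖f‖` reaches the level `c`. -/
noncomputable def reachTime (c : ℝ) (f : ℝ≥0 → V) : WithTop ℝ≥0 :=
  if ∃ t, Reaches c f t then ((sInf {t | Reaches c f t} : ℝ≥0) : WithTop ℝ≥0) else ⊤

/-- The infimum is attained, by `exists_gt_not_reaches`. Later arguments can thus compare times
through the relation `Reaches`, with no separate treatment of the value `⊤`. -/
theorem reachTime_le_iff {c : ℝ} {f : ℝ≥0 → V} (hf : ∀ t, ContinuousWithinAt f (Ici t) t)
    {t : ℝ≥0} : reachTime c f ≤ t ↔ Reaches c f t := by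
  unfold reachTime
  split_ifs with h
  · rw [WithTop.coe_le_coe]
    refine ⟨fun hle => ?_, fun hr => csInf_le (OrderBot.bddBelow _) hr⟩
    by_contra hn
    obtain ⟨u, hu, hu'⟩ := exists_gt_not_reaches (hf t) hn
    obtain ⟨v, hv, hvu⟩ := exists_lt_of_csInf_lt h (hle.trans_lt hu)
    exact hu' (Reaches.mono hv hvu.le)
  · simp only [top_le_iff, WithTop.coe_ne_top, false_iff]
    exact fun hr => h ⟨t, hr⟩

theorem lt_reachTime_iff {c : ℝ} {f : ℝ≥0 → V} (hf : ∀ t, ContinuousWithinAt f (Ici t) t)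
    {t : ℝ≥0} : t < reachTime c f ↔ ¬ Reaches c f t := by
  rw [← not_le, reachTime_le_iff hf]

theorem norm_lt_of_lt_reachTime {c : ℝ} {f : ℝ≥0 → V} (hf : ∀ t, ContinuousWithinAt f (Ici t) t)
    {t : ℝ≥0} (h : t < reachTime c f) : ‖f t‖ < c :=
  not_le.1 fun hn => (lt_reachTime_iff hf).1 h (reaches_of_le_norm hn)

theorem reachTime_pos_iff {c : ℝ} {f : ℝ≥0 → V} (hf : ∀ t, ContinuousWithinAt f (Ici t) t) :
    0 < reachTime c f ↔ ‖f 0‖ < c := by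
  rw [← WithTop.coe_zero, lt_reachTime_iff hf, reaches_zero_iff, not_le]

theorem monotone_reachTime {f : ℝ≥0 → V} (hf : ∀ t, ContinuousWithinAt f (Ici t) t) :
    Monotone fun c => reachTime c f := by
  intro c c' h
  change reachTime c f ≤ reachTime c' f
  cases h' : reachTime c' f with
  | top => exact le_top
  | coe t => exact (reachTime_le_iff hf).2 (((reachTime_le_iff hf).1 h'.le).antitone_level h)

/-- One-sided limits bound the path near each time; compactness of `[0, t]` does the rest. -/
theorem IsRCLL.exists_norm_le {f : ℝ≥0 → V} (hf : IsRCLL f) (t : ℝ≥0) :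
    ∃ C : ℝ, ∀ s ≤ t, ‖f s‖ ≤ C := by
  have h : ∃ C : ℝ, ∀ s ∈ Icc 0 t, ‖f s‖ ≤ C := by
    refine isCompact_Icc.induction_on (p := fun A => ∃ C : ℝ, ∀ s ∈ A, ‖f s‖ ≤ C)
      ⟨0, by simp⟩ (fun A B hAB ⟨C, hC⟩ => ⟨C, fun s hs => hC s (hAB hs)⟩)
      (fun A B ⟨C, hC⟩ ⟨D, hD⟩ => ⟨max C D, fun s hs => hs.elim
        (fun h => (hC s h).trans (le_max_left _ _)) fun h => (hD s h).trans (le_max_right _ _)⟩)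
      fun s _ => ?_
    obtain ⟨hr, l, hl⟩ := hf s
    have h1 : ∀ᶠ u in 𝓝[≥] s, ‖f u‖ ≤ ‖f s‖ + 1 :=
      hr.norm.eventually (Iic_mem_nhds (lt_add_one _))
    have h2 : ∀ᶠ u in 𝓝[<] s, ‖f u‖ ≤ ‖l‖ + 1 :=
      hl.norm.eventually (Iic_mem_nhds (lt_add_one _))
    have h3 : ∀ᶠ u in 𝓝 s, ‖f u‖ ≤ max (‖f s‖ + 1) (‖l‖ + 1) := by
      rw [← nhdsLT_sup_nhdsGE, eventually_sup]
      exact ⟨h2.mono fun u hu => hu.trans (le_max_right _ _),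
        h1.mono fun u hu => hu.trans (le_max_left _ _)⟩
    exact ⟨_, mem_nhdsWithin_of_mem_nhds h3, _, fun u hu => hu⟩
  obtain ⟨C, hC⟩ := h
  exact ⟨C, fun s hs => hC s ⟨zero_le, hs⟩⟩

theorem IsRCLL.tendsto_reachTime {f : ℝ≥0 → V} (hf : IsRCLL f) :
    Tendsto (fun n : ℕ => reachTime (n : ℝ) f) atTop (𝓝 ⊤) := by
  rw [WithTop.tendsto_nhds_top_iff]
  intro t
  obtain ⟨C, hC⟩ := hf.exists_norm_le t
  obtain ⟨N, hN⟩ := exists_nat_gt C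
  filter_upwards [eventually_ge_atTop N] with n hn
  rw [lt_reachTime_iff fun t => (hf t).1]
  intro hr
  obtain ⟨s, hs, h⟩ := hr C (hN.trans_le (by exact_mod_cast hn))
  exact absurd (hC s hs) (not_le.2 h)

/-! ### Stopped paths -/

/-- The time `t ∧ a`. -/
noncomputable def truncTime (a : WithTop ℝ≥0) (t : ℝ≥0) : ℝ≥0 := (min (t : WithTop ℝ≥0) a).untopA

@[simp] theorem truncTime_top (t : ℝ≥0) : truncTime ⊤ t = t := by
  rw [truncTime, min_eq_left le_top]
  exact WithTop.untopD_coe _ _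

@[simp] theorem truncTime_coe (a t : ℝ≥0) : truncTime (a : WithTop ℝ≥0) t = min t a := by
  rw [truncTime, ← WithTop.coe_min]
  exact WithTop.untopD_coe _ _

theorem coe_truncTime (a : WithTop ℝ≥0) (t : ℝ≥0) :
    (truncTime a t : WithTop ℝ≥0) = min (t : WithTop ℝ≥0) a := by
  cases a with
  | top => rw [truncTime_top, min_eq_left le_top]
  | coe a => rw [truncTime_coe, WithTop.coe_min]

theorem truncTime_eq_iff {a : WithTop ℝ≥0} {s t : ℝ≥0} :
    truncTime a t = s ↔ min (t : WithTop ℝ≥0) a = s := by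
  rw [← coe_truncTime, WithTop.coe_inj]

theorem truncTime_le (a : WithTop ℝ≥0) (t : ℝ≥0) : truncTime a t ≤ t := by
  rw [← WithTop.coe_le_coe, coe_truncTime]
  exact min_le_left _ _

theorem truncTime_eq_self {a : WithTop ℝ≥0} {t : ℝ≥0} (h : t ≤ a) : truncTime a t = t :=
  truncTime_eq_iff.2 (min_eq_left h)

theorem truncTime_truncTime (a b : WithTop ℝ≥0) (t : ℝ≥0) :
    truncTime a (truncTime b t) = truncTime (min b a) t := by
  rw [truncTime_eq_iff, coe_truncTime, coe_truncTime, min_assoc]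

theorem monotone_truncTime (a : WithTop ℝ≥0) : Monotone (truncTime a) := by
  intro s t h
  rw [← WithTop.coe_le_coe, coe_truncTime, coe_truncTime]
  exact min_le_min_right _ (WithTop.coe_le_coe.2 h)

theorem continuous_truncTime (a : WithTop ℝ≥0) : Continuous (truncTime a) := by
  cases a with
  | top => rw [funext truncTime_top]; exact continuous_id
  | coe a => rw [funext (truncTime_coe a)]; fun_prop

theorem ContinuousWithinAt.comp_truncTime {X : Type*} [TopologicalSpace X] {f : ℝ≥0 → X}
    (hf : ∀ t, ContinuousWithinAt f (Ici t) t) (a : WithTop ℝ≥0) (t : ℝ≥0) :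
    ContinuousWithinAt (fun s => f (truncTime a s)) (Ici t) t :=
  ContinuousWithinAt.comp (t := Ici (truncTime a t)) (hf _)
    (continuous_truncTime a).continuousWithinAt fun _ hs => monotone_truncTime a hs

open Classical in
/-- The path `f` stopped when it reaches the level `c`, and zero if it starts above this level. -/
noncomputable def reachStopped (c : ℝ) (f : ℝ≥0 → V) (t : ℝ≥0) : V :=
  if 0 < reachTime c f then f (truncTime (reachTime c f) t) else 0

theorem continuousWithinAt_reachStopped {c : ℝ} {f : ℝ≥0 → V}
    (hf : ∀ t, ContinuousWithinAt f (Ici t) t) (t : ℝ≥0) :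
    ContinuousWithinAt (reachStopped c f) (Ici t) t := by
  unfold reachStopped
  split_ifs
  · exact ContinuousWithinAt.comp_truncTime hf _ t
  · exact continuousWithinAt_const

/-! ### Pasting two paths -/

theorem reaches_paste_of_le {c : ℝ} {f g : ℝ≥0 → V} {r t : ℝ≥0} (hg : g 0 = f r) (ht : t ≤ r) :
    Reaches c (fun t => if t < r then f t else g (t - r)) t ↔ Reaches c f t := by
  refine forall₂_congr fun m _ => exists_congr fun s => and_congr_right fun hs => ?_
  rcases (hs.trans ht).lt_or_eq with h | rfl
  · simp [h]
  · simp [hg]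

/-- The running supremum of the pasted path is the maximum of those of its two pieces; since `g 0 =
f r`, including the time `r` in the first piece changes nothing. -/
theorem reaches_paste_of_ge {c : ℝ} {f g : ℝ≥0 → V} {r t : ℝ≥0} (hg : g 0 = f r) (ht : r ≤ t) :
    Reaches c (fun t => if t < r then f t else g (t - r)) t ↔
      Reaches c f r ∨ Reaches c g (t - r) := by
  constructor
  · intro h
    by_contra! hn
    simp only [Reaches, not_forall, not_exists, not_and, not_lt] at hn
    obtain ⟨⟨m, hm, h1⟩, m', hm', h2⟩ := hn
    obtain ⟨s, hs, hs'⟩ := h (max m m') (max_lt hm hm')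
    by_cases hsr : s < r
    · simp only [hsr, if_true] at hs'
      exact absurd ((le_max_left _ _).trans_lt hs') (not_lt.2 (h1 s hsr.le))
    · simp only [hsr, if_false] at hs'
      exact absurd ((le_max_right _ _).trans_lt hs')
        (not_lt.2 (h2 _ (tsub_le_tsub_right hs r)))
  · rintro (h | h)
    · exact ((reaches_paste_of_le hg le_rfl).2 h).mono ht
    · intro m hm
      obtain ⟨s, hs, hs'⟩ := h m hm
      refine ⟨r + s, (add_le_add_right hs r).trans (add_tsub_cancel_of_le ht).le, ?_⟩
      simpa using hs'

theorem reachTime_paste_of_le {c : ℝ} {f g : ℝ≥0 → V} {r : ℝ≥0} (hf : IsRCLL f) (hg : IsRCLL g)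
    (h0 : g 0 = f r) (h : reachTime c f ≤ r) :
    reachTime c (fun t => if t < r then f t else g (t - r)) = reachTime c f := by
  have hh := isRCLL_paste hf hg r
  refine WithTop.eq_of_forall_le_coe_iff fun t => ?_
  rw [reachTime_le_iff fun t => (hh t).1, reachTime_le_iff fun t => (hf t).1]
  rcases le_total t r with ht | ht
  · exact reaches_paste_of_le h0 ht
  · have := (reachTime_le_iff fun t => (hf t).1).1 h
    exact iff_of_true ((reaches_paste_of_ge h0 ht).2 (.inl this)) (this.mono ht)

theorem reachTime_paste_of_lt {c : ℝ} {f g : ℝ≥0 → V} {r : ℝ≥0} (hf : IsRCLL f) (hg : IsRCLL g)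
    (h0 : g 0 = f r) (h : r < reachTime c f) :
    reachTime c (fun t => if t < r then f t else g (t - r)) = r + reachTime c g := by
  have hh := isRCLL_paste hf hg r
  have hn := (lt_reachTime_iff fun t => (hf t).1).1 h
  refine WithTop.eq_of_forall_le_coe_iff fun t => ?_
  rw [reachTime_le_iff fun t => (hh t).1]
  rcases lt_or_ge t r with ht | ht
  · rw [reaches_paste_of_le h0 ht.le]
    refine iff_of_false (fun h => hn (h.mono ht.le)) (not_le.2 ?_)
    exact (WithTop.coe_lt_coe.2 ht).trans_le le_self_add
  · rw [reaches_paste_of_ge h0 ht, or_iff_right hn, ← reachTime_le_iff fun t => (hg t).1]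
    induction reachTime c g with
    | top =>
      rw [WithTop.add_top, top_le_iff, top_le_iff]
      exact iff_of_false WithTop.coe_ne_top WithTop.coe_ne_top
    | coe a =>
      rw [← WithTop.coe_add, WithTop.coe_le_coe, WithTop.coe_le_coe]
      exact le_tsub_iff_left ht

-- The identity behind the whole martingale argument. If `f` has not reached `c` by time `r`, then
-- `g` starts below `c` and the level time of the pasted path is `r` plus that of `g`. Otherwise the
-- pasted path is stopped by time `r` and `g` contributes nothing.
open Classical in
theorem reachStopped_paste {c : ℝ} {f g : ℝ≥0 → V} {r : ℝ≥0} (hf : IsRCLL f) (hg : IsRCLL g)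
    (h0 : g 0 = f r) (t : ℝ≥0) :
    reachStopped c (fun t => if t < r then f t else g (t - r)) t =
      reachStopped c f (min t r) +
        if r < reachTime c f then reachStopped c g (t - r) - reachStopped c g 0 else 0 := by
  rcases lt_or_ge (r : WithTop ℝ≥0) (reachTime c f) with h | h
  · have hpos : 0 < reachTime c f := lt_of_le_of_lt zero_le h
    have hgpos : 0 < reachTime c g := by
      rw [reachTime_pos_iff fun t => (hg t).1, h0]
      exact norm_lt_of_lt_reachTime (fun t => (hf t).1) h
    have hlt : 0 < (r : WithTop ℝ≥0) + reachTime c g := hgpos.trans_le le_add_self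
    simp only [reachStopped, reachTime_paste_of_lt hf hg h0 h, hpos, hgpos, hlt, h, if_true]
    rw [truncTime_eq_self (t := min t r) ((WithTop.coe_le_coe.2 (min_le_right t r)).trans h.le),
      truncTime_eq_self (t := 0) (by simp), h0]
    rcases lt_or_ge t r with ht | ht
    · have h1 : (t : WithTop ℝ≥0) ≤ r + reachTime c g :=
        (WithTop.coe_le_coe.2 ht.le).trans le_self_add
      rw [truncTime_eq_self h1, if_pos ht, min_eq_left ht.le, tsub_eq_zero_of_le ht.le,
        truncTime_eq_self (t := 0) (by simp), h0]
      simp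
    · have h2 : truncTime (r + reachTime c g) t = r + truncTime (reachTime c g) (t - r) := by
        induction reachTime c g with
        | top => rw [WithTop.add_top, truncTime_top, truncTime_top, add_tsub_cancel_of_le ht]
        | coe a =>
          rw [← WithTop.coe_add, truncTime_coe, truncTime_coe, ← min_add_add_left,
            add_tsub_cancel_of_le ht]
      rw [h2, min_eq_right ht]
      simp
  · rw [if_neg (not_lt.2 h), add_zero]
    have h3 : truncTime (reachTime c f) (min t r) = truncTime (reachTime c f) t := by
      rw [truncTime_eq_iff, coe_truncTime, WithTop.coe_min, min_assoc, min_eq_right h]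
    have h4 : truncTime (reachTime c f) t ≤ r := by
      rw [← h3]
      exact (truncTime_le _ _).trans (min_le_right _ _)
    simp only [reachStopped, reachTime_paste_of_le hf hg h0 h, h3]
    split_ifs with hp h5
    · rfl
    -- The stopped path can read from `g` only at time `r` itself, where `g 0 = f r`.
    · rw [h4.antisymm (not_lt.1 h5)]
      simpa using h0
    · rfl

end ReachTime

/-! ### Measurability on the path space -/

/-- The right endpoint of the cell of the grid of mesh `1 / (m + 1)` that contains `t`. -/
noncomputable def gridTime (m : ℕ) (t : ℝ≥0) : ℝ≥0 := (⌊t * (m + 1)⌋₊ + 1) / (m + 1)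

theorem lt_gridTime (m : ℕ) (t : ℝ≥0) : t < gridTime m t := by
  rw [gridTime, lt_div_iff₀ (by positivity)]
  exact Nat.lt_floor_add_one _

theorem gridTime_le (m : ℕ) (t : ℝ≥0) : gridTime m t ≤ t + 1 / (m + 1) := by
  rw [gridTime, add_div]
  gcongr
  rw [div_le_iff₀ (by positivity)]
  exact Nat.floor_le (by positivity)

theorem tendsto_gridTime (t : ℝ≥0) : Tendsto (fun m => gridTime m t) atTop (𝓝[≥] t) := by
  refine tendsto_nhdsWithin_iff.2 ⟨?_, .of_forall fun m => (lt_gridTime m t).le⟩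
  refine tendsto_of_tendsto_of_tendsto_of_le_of_le tendsto_const_nhds ?_
    (fun m => (lt_gridTime m t).le) fun m => gridTime_le m t
  have h : Tendsto (fun m : ℕ => 1 / ((m : ℝ≥0) + 1)) atTop (𝓝 0) :=
    tendsto_one_div_add_atTop_nhds_zero_nat
  simpa using tendsto_const_nhds.add h

theorem countable_range_gridTime (m : ℕ) : (range (gridTime m)).Countable :=
  (countable_range fun k : ℕ => ((k : ℝ≥0) + 1) / (m + 1)).mono <| by
    rintro _ ⟨t, rfl⟩
    exact ⟨_, rfl⟩

/-- The strict inequality on the right is the point: grid approximations of `τ` are stopping times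
as soon as each `{τ < u}` lies in the σ-algebra of time `u`, which holds for stopping times of the
right-continuous hull. -/
theorem gridTime_le_iff (m : ℕ) (t r : ℝ≥0) :
    gridTime m t ≤ r ↔ t < (⌊r * (m + 1)⌋₊ : ℝ≥0) / (m + 1) := by
  have hm : (0 : ℝ≥0) < m + 1 := by positivity
  rw [gridTime, div_le_iff₀ hm, lt_div_iff₀ hm, ← Nat.floor_lt (by positivity), ← Nat.succ_le_iff,
    Nat.le_floor_iff (by positivity), Nat.succ_eq_add_one, Nat.cast_add_one]

theorem floor_div_le (m : ℕ) (r : ℝ≥0) : (⌊r * (m + 1)⌋₊ : ℝ≥0) / (m + 1) ≤ r := by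
  rw [div_le_iff₀ (by positivity)]
  exact Nat.floor_le (by positivity)

/-! ### Right-continuous processes at random times -/

section RightContinuous

variable {X : Type*} [TopologicalSpace X] [TopologicalSpace.PseudoMetrizableSpace X]
  [MeasurableSpace X] [BorelSpace X]

/-- Approximate `T` from the right by grid times, which take countably many values. Truncation at
`a` ensures that only sections at times up to `a` are used, as progressive measurability requires.
-/
theorem measurable_uncurry_of_rightContinuous {Ω α : Type*} [MeasurableSpace Ω]
    [MeasurableSpace α] {u : ℝ≥0 → Ω → X} {a : WithTop ℝ≥0} (hu : ∀ s : ℝ≥0, s ≤ a → Measurable (u s))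
    (hc : ∀ ω t, ContinuousWithinAt (fun s => u s ω) (Ici t) t) {T : α → ℝ≥0} (hT : Measurable T)
    (hTa : ∀ x, T x ≤ a) : Measurable fun p : α × Ω => u (T p.1) p.2 := by
  refine measurable_of_tendsto_metrizable
    (f := fun (m : ℕ) (p : α × Ω) => u (truncTime a (gridTime m (T p.1))) p.2) (fun m => ?_) ?_
  · have h1 : Measurable fun q : ℕ × Ω => u (truncTime a (((q.1 : ℝ≥0) + 1) / (m + 1))) q.2 := by
      refine measurable_from_prod_countable_right fun k =>
        hu (truncTime a ((k + 1) / (m + 1))) ?_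
      rw [coe_truncTime]
      exact min_le_right _ _
    have h2 : Measurable fun p : α × Ω => (⌊T p.1 * (m + 1)⌋₊, p.2) :=
      (Nat.measurable_floor.comp ((hT.comp measurable_fst).mul_const _)).prodMk measurable_snd
    have h3 := h1.comp h2
    simpa only [gridTime, Function.comp_def] using h3
  · rw [tendsto_pi_nhds]
    intro p
    have h := ContinuousWithinAt.comp_truncTime (hc p.2) a (T p.1)
    have := h.tendsto.comp (tendsto_gridTime (T p.1))
    rwa [truncTime_eq_self (hTa _)] at this

/-- An adapted right-continuous process is progressive. -/
theorem isStronglyProgressive_of_rightContinuous [SecondCountableTopology X]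
    {Ω : Type*} {mΩ : MeasurableSpace Ω} {𝓕 : Filtration ℝ≥0 mΩ} {u : ℝ≥0 → Ω → X}
    (hu : ∀ t, Measurable[𝓕 t] (u t))
    (hc : ∀ ω t, ContinuousWithinAt (fun s => u s ω) (Ici t) t) : IsStronglyProgressive 𝓕 u := by
  intro i
  refine @Measurable.stronglyMeasurable _ _ _ (Subtype.instMeasurableSpace.prod (𝓕 i)) _ _ _ _ _ ?_
  exact @measurable_uncurry_of_rightContinuous X _ _ _ _ Ω (Iic i) (𝓕 i) _ u i
    (fun s hs => (hu s).mono (𝓕.mono (WithTop.coe_le_coe.1 hs)) le_rfl) hc _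
    measurable_subtype_coe fun s => WithTop.coe_le_coe.2 s.2

end RightContinuous

/-! ### The raw filtration and the σ-algebra of the path space -/

section PathSpace

variable {E : Type*} [TopologicalSpace E] [MeasurableSpace E]

theorem measurable_coord (t : ℝ≥0) : Measurable fun ω : PathSpace E => ω.1 t :=
  (measurable_pi_apply t).comp measurable_subtype_coe

theorem measurable_coord_rawFiltration {s t : ℝ≥0} (hst : s ≤ t) :
    Measurable[rawFiltration E t] fun ω : PathSpace E => ω.1 s :=
  Measurable.of_comap_le <|
    le_iSup₂ (f := fun s (_ : s ≤ t) => MeasurableSpace.comap (fun ω : PathSpace E => ω.1 s) _) s hst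

theorem measurable_rawFiltration_iff {α : Type*} [MeasurableSpace α] {t : ℝ≥0}
    {f : α → PathSpace E} :
    Measurable[_, rawFiltration E t] f ↔ ∀ s ≤ t, Measurable fun a => (f a).1 s := by
  refine ⟨fun h s hs => (measurable_coord_rawFiltration hs).comp h, fun h => ?_⟩
  rw [measurable_iff_comap_le]
  simp only [rawFiltration, MeasurableSpace.comap_iSup, iSup_le_iff, MeasurableSpace.comap_comp]
  exact fun s hs => (h s hs).comap_le

/-- Membership in an event of the raw filtration at time `t` depends on the path up to time `t`. -/
theorem mem_iff_of_eqOn_Iic {t : ℝ≥0} {A : Set (PathSpace E)}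
    (hA : MeasurableSet[rawFiltration E t] A) {ω ω' : PathSpace E} (h : ∀ s ≤ t, ω.1 s = ω'.1 s) :
    ω ∈ A ↔ ω' ∈ A := by
  -- The sets that do not separate `ω` from `ω'` form a σ-algebra, so it is enough to treat the
  -- coordinates up to time `t`.
  let m : MeasurableSpace (PathSpace E) :=
    { MeasurableSet' := fun A => ω ∈ A ↔ ω' ∈ A
      measurableSet_empty := Iff.rfl
      measurableSet_compl := fun _ h => not_congr h
      measurableSet_iUnion := fun f h => by simp only [mem_iUnion, h] }
  have hm : rawFiltration E t ≤ m := by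
    refine iSup₂_le fun s hs => ?_
    rintro _ ⟨B, -, rfl⟩
    change ω.1 s ∈ B ↔ ω'.1 s ∈ B
    rw [h s hs]
  exact hm A hA

/-- Once the past `ω` is frozen, an event of time `s` becomes an event of time `s - r` for the
continuation, to which its martingale property applies. -/
theorem measurable_concatPath_rawFiltration {r s : ℝ≥0} (ω : PathSpace E) :
    Measurable[rawFiltration E (s - r), rawFiltration E s] (concatPath r ω) := by
  refine @measurable_rawFiltration_iff E _ _ _ (rawFiltration E (s - r)) s _ |>.2 fun u hu => ?_
  by_cases h : u < r
  · simp only [concatPath, h, if_true]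
    exact measurable_const
  · simp only [concatPath, h, if_false]
    exact measurable_coord_rawFiltration (tsub_le_tsub_right hu r)

theorem concatPath_mem_iff_of_lt {r s : ℝ≥0} (hsr : s < r) {A : Set (PathSpace E)}
    (hA : MeasurableSet[rawFiltration E s] A) (ω ω' : PathSpace E) :
    concatPath r ω ω' ∈ A ↔ ω ∈ A :=
  mem_iff_of_eqOn_Iic hA fun u hu => by simp [concatPath, hu.trans_lt hsr]

variable [BorelSpace E] [TopologicalSpace.PseudoMetrizableSpace E]

theorem measurable_eval :
    Measurable fun p : ℝ≥0 × PathSpace E => p.2.1 p.1 :=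
  measurable_uncurry_of_rightContinuous (a := ⊤) (fun s _ => measurable_coord s)
    (fun ω t => (ω.2 t).1) measurable_id fun _ => le_top

theorem isStronglyProgressive_coord_hull [SecondCountableTopology E] :
    IsStronglyProgressive (hullFiltration E) fun t (ω : PathSpace E) => ω.1 t :=
  isStronglyProgressive_of_rightContinuous
    (fun t => (measurable_coord_rawFiltration le_rfl).mono ((rawFiltration E).le_rightCont t) le_rfl)
    fun ω t => (ω.2 t).1

instance countablyGenerated_pathSpace [SecondCountableTopology E] :
    MeasurableSpace.CountablyGenerated (PathSpace E) := by
  let q : ℕ × ℕ → ℝ≥0 := fun k => ((k.1 : ℝ≥0) + 1) / (k.2 + 1)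
  let S : ℕ × ℕ → Set (Set (PathSpace E)) := fun k =>
    preimage (fun ω : PathSpace E => ω.1 (q k)) '' MeasurableSpace.countableGeneratingSet E
  have hS (k : ℕ × ℕ) : MeasurableSpace.generateFrom (S k) =
      MeasurableSpace.comap (fun ω : PathSpace E => ω.1 (q k)) inferInstance := by
    rw [← MeasurableSpace.comap_generateFrom, MeasurableSpace.generateFrom_countableGeneratingSet]
  refine ⟨⋃ k, S k, countable_iUnion fun k =>
    (MeasurableSpace.countable_countableGeneratingSet).image _, ?_⟩
  refine le_antisymm ?_ ?_
  · let m := MeasurableSpace.generateFrom (⋃ k, S k)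
    have hq (k : ℕ × ℕ) : Measurable[m] fun ω : PathSpace E => ω.1 (q k) := by
      refine Measurable.of_comap_le ?_
      rw [← hS]
      exact MeasurableSpace.generateFrom_mono (subset_iUnion S k)
    have ht (t : ℝ≥0) : Measurable[m] fun ω : PathSpace E => ω.1 t := by
      refine @measurable_of_tendsto_metrizable _ _ m _ _ _ _
        (fun j (ω : PathSpace E) => ω.1 (gridTime j t)) _ (fun j => hq (⌊t * (j + 1)⌋₊, j)) ?_
      rw [tendsto_pi_nhds]
      exact fun ω => (ω.2 t).1.tendsto.comp (tendsto_gridTime t)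
    change MeasurableSpace.comap _ _ ≤ m
    rw [← measurable_iff_comap_le]
    exact @measurable_pi_lambda _ _ _ m _ _ ht
  · refine MeasurableSpace.generateFrom_le fun A hA => ?_
    obtain ⟨k, B, hB, rfl⟩ := mem_iUnion.1 hA
    exact measurable_coord _ (MeasurableSpace.measurableSet_countableGeneratingSet hB)

/-- Concatenation at the random time `τ` is jointly measurable. -/
theorem measurable_concatPath {τ : PathSpace E → ℝ≥0} (hτ : Measurable τ) :
    Measurable fun p : PathSpace E × PathSpace E => concatPath (τ p.1) p.1 p.2 := by
  refine Measurable.subtype_mk (measurable_pi_lambda _ fun t => ?_)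
  refine Measurable.ite (measurableSet_lt measurable_const (hτ.comp measurable_fst))
    ((measurable_coord t).comp measurable_fst) ?_
  exact measurable_eval.comp ((measurable_const.sub (hτ.comp measurable_fst)).prodMk measurable_snd)

end PathSpace

/-! ### Optional stopping of right-continuous martingales -/

section OptionalStopping

variable {Ω : Type*} {mΩ : MeasurableSpace Ω} {μ : Measure Ω} [IsFiniteMeasure μ]

theorem martingale_of_setIntegral_eq {V : Type*} [NormedAddCommGroup V] [NormedSpace ℝ V]
    [CompleteSpace V] {𝓕 : Filtration ℝ≥0 mΩ} {M : ℝ≥0 → Ω → V} (ha : StronglyAdapted 𝓕 M)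
    (hi : ∀ t, Integrable (M t) μ)
    (h : ∀ s t, s < t → ∀ A, MeasurableSet[𝓕 s] A → ∫ ω in A, M s ω ∂μ = ∫ ω in A, M t ω ∂μ) :
    Martingale M 𝓕 μ := by
  refine ⟨ha, fun s t hst => ?_⟩
  refine (ae_eq_condExp_of_forall_setIntegral_eq (𝓕.le s) (hi t)
    (fun _ _ _ => (hi s).integrableOn) (fun A hA _ => ?_) (ha s).aestronglyMeasurable).symm
  rcases hst.eq_or_lt with rfl | hst
  · rfl
  · exact h s t hst A hA

variable {𝓕 : Filtration ℝ≥0 mΩ} {M : ℝ≥0 → Ω → ℝ}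

theorem isStoppingTime_gridTime {τ : Ω → ℝ≥0} (hτ : ∀ u, MeasurableSet[𝓕 u] {ω | τ ω < u})
    (m : ℕ) (t : ℝ≥0) :
    IsStoppingTime 𝓕 fun ω => ((min (gridTime m (τ ω)) t : ℝ≥0) : WithTop ℝ≥0) := by
  intro r
  simp only [WithTop.coe_le_coe, min_le_iff, gridTime_le_iff, ofPred_or]
  exact (𝓕.mono (floor_div_le m r) _ (hτ _)).union (MeasurableSet.const _)

/-- Optional stopping at a time `τ` with `{τ < u} ∈ 𝓕 u`, on an event of `𝓕 s+` on which
`τ ≥ s`. -/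
theorem MeasureTheory.Martingale.optional_stopping (hM : Martingale M 𝓕 μ)
    (hc : ∀ ω t, ContinuousWithinAt (fun s => M s ω) (Ici t) t) {τ : Ω → ℝ≥0}
    (hτ : ∀ u, MeasurableSet[𝓕 u] {ω | τ ω < u}) (t : ℝ≥0) :
    Integrable (fun ω => M (min (τ ω) t) ω) μ ∧
      ∀ s < t, ∀ B, (∀ r > s, MeasurableSet[𝓕 r] B) → (∀ ω ∈ B, s ≤ τ ω) →
        ∫ ω in B, M (min (τ ω) t) ω ∂μ = ∫ ω in B, M t ω ∂μ := by
  have hst (m : ℕ) := isStoppingTime_gridTime hτ m t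
  set f : ℕ → Ω → ℝ := fun m ω => M (min (gridTime m (τ ω)) t) ω with hf
  have hcond (m : ℕ) : f m =ᵐ[μ] μ[M t | (hst m).measurableSpace] := by
    refine hM.stoppedValue_ae_eq_condExp_of_le_const_of_countable_range (hst m)
      (fun ω => WithTop.coe_le_coe.2 (min_le_right _ _)) ?_
    refine ((countable_range_gridTime m).image
      fun r => ((min r t : ℝ≥0) : WithTop ℝ≥0)).mono ?_
    rintro _ ⟨ω, rfl⟩
    exact ⟨_, ⟨τ ω, rfl⟩, rfl⟩
  have hfi (m : ℕ) : Integrable (f m) μ := integrable_condExp.congr (hcond m).symm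
  have hlim (ω : Ω) : Tendsto (fun m => f m ω) atTop (𝓝 (M (min (τ ω) t) ω)) := by
    refine (hc ω (min (τ ω) t)).tendsto.comp (tendsto_nhdsWithin_iff.2 ⟨?_, .of_forall fun m =>
      min_le_min_right _ (lt_gridTime m _).le⟩)
    exact ((tendsto_gridTime (τ ω)).mono_right nhdsWithin_le_nhds).min tendsto_const_nhds
  -- Conditional expectations of a single integrable variable are uniformly integrable, so the
  -- pointwise limit is also a limit in `L¹`.
  have hui : UniformIntegrable f 1 μ :=
    ((hM.integrable t).uniformIntegrable_condExp fun m => (hst m).measurableSpace_le).ae_eq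
      fun m => (hcond m).symm
  have hgi : MemLp (fun ω => M (min (τ ω) t) ω) 1 μ :=
    hui.memLp_of_ae_tendsto (u := atTop) (.of_forall hlim)
  have hL1 := tendsto_Lp_finite_of_tendsto_ae le_rfl ENNReal.one_ne_top
    (fun m => (hfi m).aestronglyMeasurable) hgi hui.2.1 (.of_forall hlim)
  refine ⟨memLp_one_iff_integrable.1 hgi, fun s hs B hB hBτ => ?_⟩
  have hint (m : ℕ) : ∫ ω in B, f m ω ∂μ = ∫ ω in B, M t ω ∂μ := by
    rw [← setIntegral_condExp (hst m).measurableSpace_le (hM.integrable t) ?_]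
    · exact setIntegral_congr_ae (𝓕.le t _ (hB t hs)) ((hcond m).mono fun ω h _ => h)
    refine ⟨?_, fun r => ?_⟩
    · exact le_iSup 𝓕 t _ (hB t hs)
    · rcases lt_or_ge s r with hr | hr
      · exact (hB r hr).inter (hst m r)
      -- For `r ≤ s` the event is empty: grid times strictly exceed `τ`, and `τ ≥ s` on `B`. Hence
      -- membership of `B` in the σ-algebras after `s` suffices.
      · convert! MeasurableSet.empty
        refine eq_empty_of_forall_notMem fun ω ⟨h1, h2⟩ => ?_
        refine absurd (WithTop.coe_le_coe.1 h2) (not_le.2 (lt_min ?_ (hr.trans_lt hs)))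
        exact (hr.trans (hBτ ω h1)).trans_lt (lt_gridTime m _)
  have h := tendsto_setIntegral_of_L1' _ hgi.1 (.of_forall hfi) hL1 B
  simp only [hint] at h
  exact tendsto_nhds_unique h tendsto_const_nhds

theorem measurableSet_truncTime_lt {ρ : Ω → WithTop ℝ≥0} (hρ : IsStoppingTime 𝓕 ρ) (t u : ℝ≥0) :
    MeasurableSet[𝓕 u] {ω | truncTime (ρ ω) t < u} := by
  have h : {ω | truncTime (ρ ω) t < u} = {ω | ρ ω < u} ∪ {_ω | t < u} := by
    ext ω
    change truncTime (ρ ω) t < u ↔ ρ ω < u ∨ t < u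
    rw [← WithTop.coe_lt_coe, coe_truncTime, min_lt_iff, WithTop.coe_lt_coe, or_comm]
  rw [h]
  exact (hρ.measurableSet_lt u).union (MeasurableSet.const _)

/-- A right-continuous martingale stopped at a stopping time is a martingale. -/
theorem MeasureTheory.Martingale.optional_stopping_truncTime (hM : Martingale M 𝓕 μ)
    (hc : ∀ ω t, ContinuousWithinAt (fun s => M s ω) (Ici t) t) {ρ : Ω → WithTop ℝ≥0}
    (hρ : IsStoppingTime 𝓕 ρ) :
    (∀ t, Integrable (fun ω => M (truncTime (ρ ω) t) ω) μ) ∧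
      ∀ s t, s < t → ∀ B, MeasurableSet[𝓕 s] B →
        ∫ ω in B, M (truncTime (ρ ω) s) ω ∂μ = ∫ ω in B, M (truncTime (ρ ω) t) ω ∂μ := by
  have hmin (t : ℝ≥0) (ω : Ω) : min (truncTime (ρ ω) t) t = truncTime (ρ ω) t :=
    min_eq_left (truncTime_le _ _)
  have hi (t : ℝ≥0) : Integrable (fun ω => M (truncTime (ρ ω) t) ω) μ := by
    simpa only [hmin] using (hM.optional_stopping hc (measurableSet_truncTime_lt hρ t) t).1
  refine ⟨hi, fun s t hst B hB => ?_⟩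
  have hle := hρ.measurableSet_le s
  have hs := 𝓕.le s
  rw [← integral_inter_add_sdiff (hs _ hle) (hi s).integrableOn,
    ← integral_inter_add_sdiff (hs _ hle) (hi t).integrableOn]
  congr 1
  · refine setIntegral_congr_fun (hs _ (hB.inter hle)) fun ω hω => ?_
    have h1 : ρ ω ≤ s := hω.2
    have : truncTime (ρ ω) s = truncTime (ρ ω) t := by
      rw [truncTime_eq_iff, coe_truncTime, min_eq_right h1,
        min_eq_right (h1.trans (WithTop.coe_le_coe.2 hst.le))]
    simp only [this]
  · have hB' : MeasurableSet[𝓕 s] (B \ {ω | ρ ω ≤ s}) := hB.diff hle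
    have h1 (ω) (hω : ω ∈ B \ {ω | ρ ω ≤ s}) : s ≤ ρ ω := (not_le.1 hω.2).le
    have h2 := (hM.optional_stopping hc (measurableSet_truncTime_lt hρ t) t).2 s hst _
      (fun r hr => 𝓕.mono hr.le _ hB') fun ω hω => by
        rw [← WithTop.coe_le_coe, coe_truncTime]
        exact le_min (WithTop.coe_le_coe.2 hst.le) (h1 ω hω)
    simp only [hmin] at h2
    rw [h2, ← hM.setIntegral_eq hst.le hB']
    exact setIntegral_congr_fun (hs _ hB') fun ω hω => by simp only [truncTime_eq_self (h1 ω hω)]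

end OptionalStopping

/-! ### The stopped price process -/

section Price

variable {d : ℕ} {F : Type*} [TopologicalSpace F]

theorem isRCLL_price (ω : PathSpace (MarketState d F)) :
    IsRCLL fun t => priceProcess d F t ω := by
  have hc : Continuous fun x : MarketState d F => x.2.1 := by fun_prop
  intro t
  obtain ⟨h1, l, h2⟩ := ω.2 t
  exact ⟨hc.continuousAt.comp_continuousWithinAt h1, _, (hc.tendsto l).comp h2⟩

/-- The first time at which the running supremum of the price reaches the level `n`. -/
noncomputable def levelTime (d : ℕ) (F : Type*) [TopologicalSpace F] (n : ℕ)
    (ω : PathSpace (MarketState d F)) : WithTop ℝ≥0 :=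
  reachTime n fun t => priceProcess d F t ω

/-- The price stopped at the level time, and zero if it starts above the level. -/
noncomputable def levelStopped (d : ℕ) (F : Type*) [TopologicalSpace F] (n : ℕ) (t : ℝ≥0)
    (ω : PathSpace (MarketState d F)) : EuclideanSpace ℝ (Fin d) :=
  reachStopped n (fun t => priceProcess d F t ω) t

/-- Transfers the lower bound assumed up to the exit time. The inequality can be strict: the norm
may approach `n` as a left limit and then jump down. -/
theorem levelTime_le_exitTime (n : ℕ) (ω : PathSpace (MarketState d F)) :
    levelTime d F n ω ≤ exitTime d F n ω := by
  unfold exitTime hittingAfter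
  split_ifs with h
  · have hj (j : ℝ≥0) (hj : priceProcess d F j ω ∈ {s | (n : ℝ) ≤ ‖s‖}) :
        levelTime d F n ω ≤ j :=
      (reachTime_le_iff fun t => (isRCLL_price ω t).1).2 (reaches_of_le_norm hj)
    obtain ⟨j, hj0, hj1⟩ := h
    lift levelTime d F n ω to ℝ≥0 using ne_top_of_le_ne_top WithTop.coe_ne_top (hj j hj1) with a
    exact WithTop.coe_le_coe.2
      (le_csInf ⟨j, hj0, hj1⟩ fun k hk => WithTop.coe_le_coe.1 (hj k hk.2))
  · exact le_top

/-- The left side is the process that `Locally` requires to be a martingale; its indicator is the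
reason for the value zero in `reachStopped`. -/
theorem stoppedProcess_levelTime (n : ℕ) :
    stoppedProcess (fun t => {ω | ⊥ < levelTime d F n ω}.indicator (priceProcess d F t))
      (levelTime d F n) = levelStopped d F n := by
  ext1 t
  ext1 ω
  simp only [stoppedProcess, levelStopped, reachStopped, indicator_apply]
  rfl

variable [MeasurableSpace F]

theorem measurable_price_rawFiltration {s t : ℝ≥0} (hst : s ≤ t) :
    Measurable[rawFiltration (MarketState d F) t] (priceProcess d F s) := by
  have : Measurable fun x : MarketState d F => x.2.1 := by fun_prop
  exact this.comp (measurable_coord_rawFiltration hst)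

theorem isStoppingTime_levelTime (n : ℕ) :
    IsStoppingTime (rawFiltration (MarketState d F)) (levelTime d F n) := by
  intro t
  have h : {ω | levelTime d F n ω ≤ t} = ⋂ k : ℕ, ⋃ q : ℕ × ℕ,
      {ω | (n : ℝ) - 1 / (k + 1) < ‖(priceProcess d F (min ((q.1 + 1) / (q.2 + 1)) t) ω)‖} := by
    ext ω
    simp only [mem_iInter, mem_iUnion]
    change levelTime d F n ω ≤ t ↔ _
    rw [levelTime, reachTime_le_iff fun t => (isRCLL_price ω t).1]
    -- Right-continuity moves a time at which the norm exceeds `n - 1 / (k + 1)` to a grid time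
    -- capped at `t`.
    constructor
    · intro h k
      obtain ⟨s, hs, h⟩ := h _ (sub_lt_self (n : ℝ) (Nat.one_div_pos_of_nat (n := k)))
      have h1 := (ContinuousWithinAt.comp_truncTime (fun u => (isRCLL_price ω u).1) t
        s).tendsto.comp (tendsto_gridTime s)
      simp only [truncTime_coe, min_eq_left hs] at h1
      obtain ⟨m, hm⟩ := (h1.norm.eventually (Ioi_mem_nhds h)).exists
      exact ⟨(⌊s * (m + 1)⌋₊, m), hm⟩
    · intro h m hm
      obtain ⟨k, hk⟩ := exists_nat_one_div_lt (sub_pos.2 hm)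
      obtain ⟨q, hq⟩ := h k
      exact ⟨_, min_le_right _ _, lt_of_le_of_lt (by linarith) hq⟩
  rw [h]
  refine MeasurableSet.iInter fun k => MeasurableSet.iUnion fun q => ?_
  exact measurableSet_lt measurable_const
    (measurable_norm.comp (measurable_price_rawFiltration (min_le_right _ _)))

theorem stronglyMeasurable_levelStopped (n : ℕ) (t : ℝ≥0) :
    StronglyMeasurable[rawFiltration (MarketState d F) t] (levelStopped d F n t) := by
  have hprog : IsStronglyProgressive (rawFiltration (MarketState d F)) (priceProcess d F) :=
    isStronglyProgressive_of_rightContinuous (fun _ => measurable_price_rawFiltration le_rfl)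
      fun ω t => (isRCLL_price ω t).1
  have h2 := hprog.stronglyAdapted_stoppedProcess (isStoppingTime_levelTime n) t
  have h3 : levelStopped d F n t = {ω | 0 < levelTime d F n ω}.indicator
      (stoppedProcess (priceProcess d F) (levelTime d F n) t) := by
    ext1 ω
    simp only [stoppedProcess, levelStopped, reachStopped, indicator_apply]
    rfl
  rw [h3]
  refine h2.indicator ((rawFiltration _).mono (zero_le (a := t)) _ ?_)
  exact (isStoppingTime_levelTime n).measurableSet_gt 0

end Price

/-! ### The stopped price under a local martingale measure -/

section Price

variable {d : ℕ} {F : Type*} [TopologicalSpace F] [MeasurableSpace F]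

open Classical in
theorem stoppedProcess_indicator_apply {Ω V : Type*} [Zero V] (X : ℝ≥0 → Ω → V)
    (σ : Ω → WithTop ℝ≥0) (t : ℝ≥0) (ω : Ω) :
    stoppedProcess (fun t => {ω | ⊥ < σ ω}.indicator (X t)) σ t ω =
      if 0 < σ ω then X (truncTime (σ ω) t) ω else 0 := by
  simp only [stoppedProcess, indicator_apply]
  rfl

theorem MeasureTheory.Martingale.coord {Ω : Type*} {mΩ : MeasurableSpace Ω} {μ : Measure Ω}
    [IsFiniteMeasure μ] {𝓕 : Filtration ℝ≥0 mΩ} {M : ℝ≥0 → Ω → EuclideanSpace ℝ (Fin d)}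
    (hM : Martingale M 𝓕 μ) (i : Fin d) : Martingale (fun t ω => M t ω i) 𝓕 μ := by
  have hi (t : ℝ≥0) : Integrable (M t) μ := hM.integrable t
  have hc : Continuous fun v : EuclideanSpace ℝ (Fin d) => v i := by fun_prop
  refine martingale_of_setIntegral_eq (fun t => hc.comp_stronglyMeasurable (hM.stronglyMeasurable t))
    (fun t => (hi t).eval_piLp i) fun s t hst A hA => ?_
  rw [← eval_integral_piLp fun j => ((hi s).eval_piLp j).integrableOn,
    ← eval_integral_piLp fun j => ((hi t).eval_piLp j).integrableOn, hM.setIntegral_eq hst.le hA]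

/-- Under a law for which the price is a local martingale bounded from below up to the level time,
the price stopped at the level time is a martingale, bounded in `L¹` by a constant that only depends
on the level and the lower bound. -/
theorem martingale_levelStopped {Q : Measure (PathSpace (MarketState d F))}
    [IsProbabilityMeasure Q] (hQ : Locally (fun Y => Martingale Y (rawFiltration (MarketState d F)) Q)
      (rawFiltration (MarketState d F)) (priceProcess d F) Q) {n : ℕ} {a : ℝ}
    (ha : ∀ᵐ ω ∂Q, 0 < levelTime d F n ω → ∀ t : ℝ≥0, t ≤ levelTime d F n ω →
      ∀ i, a ≤ priceProcess d F t ω i) (i : Fin d) :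
    Martingale (fun t ω => levelStopped d F n t ω i) (rawFiltration (MarketState d F)) Q ∧
      ∀ t, ∫ ω, |levelStopped d F n t ω i| ∂Q ≤ n + 2 * |a| := by
  classical
  obtain ⟨σ, hσ, hM⟩ := hQ
  have hρ := isStoppingTime_levelTime (d := d) (F := F) n
  set ρ := levelTime d F n with hρdef
  set 𝓕 := rawFiltration (MarketState d F)
  have hpos : MeasurableSet[𝓕 0] {ω | 0 < ρ ω} := hρ.measurableSet_gt 0
  -- the localized price, stopped at the level time
  set W : ℕ → ℝ≥0 → PathSpace (MarketState d F) → ℝ := fun k t ω =>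
    if 0 < ρ ω ∧ 0 < σ k ω then priceProcess d F (truncTime (min (ρ ω) (σ k ω)) t) ω i else 0
    with hW
  have hWM (k : ℕ) : (∀ t, Integrable (W k t) Q) ∧ ∀ s t, s < t → ∀ B, MeasurableSet[𝓕 s] B →
      ∫ ω in B, W k s ω ∂Q = ∫ ω in B, W k t ω ∂Q := by
    have h := ((hM k).coord i).optional_stopping_truncTime (ρ := ρ) ?_ hρ
    · have hWeq (t : ℝ≥0) : W k t = {ω | 0 < ρ ω}.indicator fun ω =>
          stoppedProcess (fun t => {ω | ⊥ < σ k ω}.indicator (priceProcess d F t)) (σ k)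
            (truncTime (ρ ω) t) ω i := by
        ext1 ω
        simp only [hW, ← truncTime_truncTime, indicator_apply, stoppedProcess_indicator_apply]
        change _ = if 0 < ρ ω then _ else _
        by_cases h1 : 0 < ρ ω <;> by_cases h2 : 0 < σ k ω <;> simp [h1, h2]
      refine ⟨fun t => hWeq t ▸ (h.1 t).indicator (𝓕.le 0 _ hpos), fun s t hst B hB => ?_⟩
      rw [hWeq, hWeq, setIntegral_indicator (𝓕.le 0 _ hpos), setIntegral_indicator (𝓕.le 0 _ hpos)]
      exact h.2 s t hst _ (hB.inter (𝓕.mono zero_le _ hpos))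
    · intro ω t
      simp only [stoppedProcess_indicator_apply]
      split_ifs
      · have hc : Continuous fun v : EuclideanSpace ℝ (Fin d) => v i := by fun_prop
        exact hc.continuousAt.comp_continuousWithinAt
          (ContinuousWithinAt.comp_truncTime (fun u => (isRCLL_price ω u).1) (σ k ω) t)
      · exact continuousWithinAt_const
  have hW0 (k : ℕ) (ω) : W k 0 ω ≤ n := by
    simp only [hW]
    split_ifs with h
    · rw [truncTime_eq_self zero_le]
      have h1 := norm_lt_of_lt_reachTime (fun u => (isRCLL_price ω u).1) (t := 0) h.1
      exact (le_abs_self _).trans ((PiLp.norm_apply_le _ i).trans h1.le)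
    · positivity
  have hWge (t : ℝ≥0) (k : ℕ) : ∀ᵐ ω ∂Q, -|a| ≤ W k t ω := by
    filter_upwards [ha] with ω hω
    simp only [hW]
    split_ifs with h
    · refine (neg_abs_le a).trans (hω h.1 _ ?_ i)
      rw [coe_truncTime]
      exact (min_le_right _ _).trans (min_le_left _ _)
    · simp
  -- The lower bound gives `|W| ≤ W + 2|a|`, and `W` has constant expectation, at most `n` because
  -- `W` starts below `n`.
  have hWint (t : ℝ≥0) (k : ℕ) : ∫ ω, |W k t ω| ∂Q ≤ n + 2 * |a| := by
    have h1 : ∫ ω, |W k t ω| ∂Q ≤ ∫ ω, (W k t ω + 2 * |a|) ∂Q := by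
      refine integral_mono_ae ((hWM k).1 t).abs (((hWM k).1 t).add (integrable_const _)) ?_
      filter_upwards [hWge t k] with ω hω
      exact abs_le.2 ⟨by linarith, by linarith [abs_nonneg a]⟩
    have h2 : ∫ ω, W k t ω ∂Q ≤ n := by
      have h3 : ∫ ω, W k t ω ∂Q = ∫ ω, W k 0 ω ∂Q := by
        rcases (zero_le (a := t)).eq_or_lt with rfl | ht
        · rfl
        · simpa using ((hWM k).2 0 t ht univ MeasurableSet.univ).symm
      rw [h3]
      simpa using integral_mono ((hWM k).1 0) (integrable_const (n : ℝ)) (hW0 k)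
    rw [integral_add ((hWM k).1 t) (integrable_const _)] at h1
    simp at h1
    linarith
  have hlim (t : ℝ≥0) : ∀ᵐ ω ∂Q, Tendsto (fun k => W k t ω) atTop
      (𝓝 (levelStopped d F n t ω i)) := by
    filter_upwards [hσ.tendsto_top] with ω hω
    refine tendsto_const_nhds.congr' ?_
    filter_upwards [(WithTop.tendsto_nhds_top_iff _).1 hω t] with k hk
    have h0 : 0 < σ k ω := lt_of_le_of_lt zero_le hk
    have h1 : truncTime (min (ρ ω) (σ k ω)) t = truncTime (ρ ω) t := by
      rw [truncTime_eq_iff, coe_truncTime, min_comm (ρ ω), ← min_assoc, min_eq_left hk.le]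
    simp only [hW, h0, h1, and_true, levelStopped, reachStopped]
    change (if 0 < ρ ω then _ else _ : EuclideanSpace ℝ (Fin d)) i = _
    split_ifs <;> rfl
  have hadapt (t : ℝ≥0) : StronglyMeasurable[𝓕 t] fun ω => levelStopped d F n t ω i :=
    (by fun_prop : Continuous fun v : EuclideanSpace ℝ (Fin d) => v i).comp_stronglyMeasurable
      (stronglyMeasurable_levelStopped n t)
  have hYnorm (t : ℝ≥0) : eLpNorm (fun ω => levelStopped d F n t ω i) 1 Q ≤
      ENNReal.ofReal (n + 2 * |a|) := by
    refine Lp.eLpNorm_le_of_ae_tendsto (f := fun k => W k t) (u := atTop) (.of_forall fun k => ?_)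
      (fun k => ((hWM k).1 t).aestronglyMeasurable) (hlim t)
    rw [eLpNorm_one_eq_lintegral_enorm, ← ofReal_integral_norm_eq_lintegral_enorm ((hWM k).1 t)]
    exact ENNReal.ofReal_le_ofReal (hWint t k)
  have hYi (t : ℝ≥0) : Integrable (fun ω => levelStopped d F n t ω i) Q :=
    memLp_one_iff_integrable.1 ⟨((hadapt t).mono (𝓕.le t)).aestronglyMeasurable,
      (hYnorm t).trans_lt ENNReal.ofReal_lt_top⟩
  -- Strictly before the level time the price has norm below `n`; from then on the localized process
  -- already equals its limit.
  have hdom (t : ℝ≥0) (k : ℕ) (ω) : |W k t ω| ≤ n + |levelStopped d F n t ω i| := by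
    simp only [hW]
    split_ifs with h
    · have hS := PiLp.norm_apply_le (priceProcess d F (truncTime (min (ρ ω) (σ k ω)) t) ω) i
      rw [Real.norm_eq_abs] at hS
      rcases lt_or_ge (truncTime (min (ρ ω) (σ k ω)) t : WithTop ℝ≥0) (ρ ω) with h1 | h1
      · have h2 := norm_lt_of_lt_reachTime (fun u => (isRCLL_price ω u).1) h1
        linarith [abs_nonneg (levelStopped d F n t ω i)]
      · have h2 : truncTime (min (ρ ω) (σ k ω)) t = truncTime (ρ ω) t := by
          rw [← WithTop.coe_inj, coe_truncTime, coe_truncTime] at *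
          refine le_antisymm (min_le_min_left _ (min_le_left _ _)) ?_
          exact (min_le_right _ _).trans h1
        have h3 : levelStopped d F n t ω = priceProcess d F (truncTime (ρ ω) t) ω := if_pos h.1
        rw [h2, h3]
        exact le_add_of_nonneg_left n.cast_nonneg
    · simp only [abs_zero]
      positivity
  refine ⟨martingale_of_setIntegral_eq hadapt hYi fun s t hst B hB => ?_, fun t => ?_⟩
  · have h (t : ℝ≥0) : Tendsto (fun k => ∫ ω in B, W k t ω ∂Q) atTop
        (𝓝 (∫ ω in B, levelStopped d F n t ω i ∂Q)) :=
      tendsto_integral_of_dominated_convergence (fun ω => n + |levelStopped d F n t ω i|)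
        (fun k => ((hWM k).1 t).aestronglyMeasurable.restrict)
        ((integrable_const _).add (hYi t).abs).integrableOn
        (fun k => .of_forall fun ω => hdom t k ω) (ae_restrict_of_ae (hlim t))
    refine tendsto_nhds_unique (h s) ?_
    simpa only [(hWM _).2 s t hst B hB] using h t
  · have := hYnorm t
    rw [eLpNorm_one_eq_lintegral_enorm, ← ofReal_integral_norm_eq_lintegral_enorm (hYi t)] at this
    exact (ENNReal.ofReal_le_ofReal_iff (by positivity)).1 this

end Price

/-! ### Concatenation of laws -/

section Concat

variable {E : Type*} [TopologicalSpace E]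

theorem concatPath_shiftPath (r : ℝ≥0) (ω : PathSpace E) : concatPath r ω (shiftPath r ω) = ω := by
  refine Subtype.ext (funext fun t => ?_)
  simp only [concatPath, shiftPath]
  split_ifs with h
  · rfl
  · rw [add_tsub_cancel_of_le (not_lt.1 h)]

variable [MeasurableSpace E]

theorem IsHullStoppingTime.measurable' {τ : PathSpace E → ℝ≥0} (hτ : IsHullStoppingTime τ) :
    Measurable[IsStoppingTime.measurableSpace hτ] τ :=
  (IsStoppingTime.measurable hτ).untopA

theorem IsHullStoppingTime.measurable {τ : PathSpace E → ℝ≥0} (hτ : IsHullStoppingTime τ) :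
    Measurable τ := hτ.measurable'.mono (IsStoppingTime.measurableSpace_le hτ) le_rfl

/-- Exhaust `{τ < u}` by `{τ ≤ v}` for countably many `v < u`; each is in the hull at `v`, hence in
the raw σ-algebra at `u`. -/
theorem IsHullStoppingTime.measurableSet_lt {τ : PathSpace E → ℝ≥0} (hτ : IsHullStoppingTime τ)
    (u : ℝ≥0) : MeasurableSet[rawFiltration E u] {ω | τ ω < u} := by
  rcases (zero_le (a := u)).eq_or_lt with rfl | hu
  · simp
  obtain ⟨v, -, hv, hlim⟩ := exists_seq_strictMono_tendsto' hu
  have h : {ω | τ ω < u} = ⋃ n, {ω | (τ ω : WithTop ℝ≥0) ≤ v n} := by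
    ext ω
    simp only [mem_iUnion]
    change τ ω < u ↔ ∃ n, (τ ω : WithTop ℝ≥0) ≤ v n
    simp only [WithTop.coe_le_coe]
    refine ⟨fun h => ?_, fun ⟨n, hn⟩ => hn.trans_lt (hv n).2⟩
    obtain ⟨n, hn⟩ := (hlim.eventually (Ioi_mem_nhds h)).exists
    exact ⟨n, hn.le⟩
  rw [h]
  refine MeasurableSet.iUnion fun n => ?_
  have hm := hτ (v n)
  rw [hullFiltration, Filtration.rightCont_eq] at hm
  exact iInf₂_le (f := fun j (_ : j > v n) => rawFiltration E j) u (hv n).2 _ hm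

/-- The concatenation of laws, through a measurable modification of the kernel. -/
theorem concatLaw_eq_map_compProd {Q : Measure (PathSpace E)} [IsProbabilityMeasure Q]
    {τ : PathSpace E → ℝ≥0} {ν : E → Measure (PathSpace E)}
    {κ : Kernel (PathSpace E) (PathSpace E)} [IsMarkovKernel κ]
    (hκ : ∀ᵐ ω ∂Q, κ ω = ν (ω.1 (τ ω))) :
    concatLaw Q τ ν = (Q ⊗ₘ κ).map fun p => concatPath (τ p.1) p.1 p.2 := by
  rw [concatLaw, productLaw, Measure.compProd_eq_comp_prod]
  congr 1
  refine Measure.bind_congr_right ?_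
  filter_upwards [hκ] with ω hω
  rw [Kernel.prod_apply, Kernel.id_apply, Measure.dirac_prod, hω]

variable [BorelSpace E] [TopologicalSpace.PseudoMetrizableSpace E]

theorem measurable_shiftPath {τ : PathSpace E → ℝ≥0} (hτ : Measurable τ) :
    Measurable fun ω => shiftPath (τ ω) ω := by
  refine Measurable.subtype_mk (measurable_pi_lambda _ fun t => ?_)
  exact _root_.measurable_eval.comp ((hτ.add measurable_const).prodMk measurable_id)

variable [SecondCountableTopology E]

/-- A universally measurable kernel agrees almost everywhere with a measurable one. -/
theorem IsUniversalKernel.exists_kernel {ν : E → Measure (PathSpace E)} (hν : IsUniversalKernel ν)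
    (μ : Measure E) [IsProbabilityMeasure μ] :
    ∃ κ : Kernel E (PathSpace E), IsMarkovKernel κ ∧ ∀ᵐ x ∂μ, κ x = ν x := by
  classical
  obtain ⟨x₀⟩ := μ.nonempty_of_neZero
  have hp := hν.isProbabilityMeasure
  -- A countable generating algebra lets a single null set absorb the exceptional sets of all `x ↦ ν
  -- x A`; on that null set the kernel is reset to the fixed law `ν x₀`.
  set S := generateSetAlgebra (MeasurableSpace.countableGeneratingSet (PathSpace E))
  have hS : S.Countable :=
    countable_generateSetAlgebra MeasurableSpace.countable_countableGeneratingSet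
  have hgen : (inferInstance : MeasurableSpace (PathSpace E)) = MeasurableSpace.generateFrom S := by
    rw [generateFrom_generateSetAlgebra_eq, MeasurableSpace.generateFrom_countableGeneratingSet]
  have hSm (A) (hA : A ∈ S) : MeasurableSet A :=
    hgen.ge A (MeasurableSpace.measurableSet_generateFrom hA)
  have hae (A) (hA : A ∈ S) : AEMeasurable (fun x => ν x A) μ :=
    NullMeasurable.aemeasurable fun B hB => hν.measurable_apply A (hSm A hA) hB μ inferInstance
  have hN : ∀ᵐ x ∂μ, ∀ A (hA : A ∈ S), ν x A = (hae A hA).mk _ x :=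
    (ae_ball_iff hS).2 fun A hA => (hae A hA).ae_eq_mk
  obtain ⟨G, hG, hGm, hμG⟩ := hN.exists_measurable_mem
  let k : E → Measure (PathSpace E) := fun x => if x ∈ G then ν x else ν x₀
  have hk (x : E) : IsProbabilityMeasure (k x) := by
    simp only [k]
    split_ifs <;> exact hp _
  have hkm : Measurable k := by
    refine Measurable.measure_of_isPiSystem_of_isProbabilityMeasure hgen
      (fun A hA B hB _ => isSetAlgebra_generateSetAlgebra.inter_mem hA hB) fun A hA => ?_
    have : (fun x => k x A) = fun x => if x ∈ G then (hae A hA).mk _ x else ν x₀ A := by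
      ext x
      simp only [k]
      split_ifs with h
      · exact hμG x h A hA
      · rfl
    rw [this]
    exact Measurable.ite hGm (hae A hA).measurable_mk measurable_const
  refine ⟨⟨k, hkm⟩, ⟨hk⟩, ?_⟩
  filter_upwards [hG] with x hx
  exact if_pos hx

theorem IsHullStoppingTime.measurable_eval {τ : PathSpace E → ℝ≥0} (hτ : IsHullStoppingTime τ) :
    Measurable[IsStoppingTime.measurableSpace hτ] fun ω : PathSpace E => ω.1 (τ ω) :=
  measurable_stoppedValue isStronglyProgressive_coord_hull hτ

theorem IsHullStoppingTime.measurable_eval_min {τ : PathSpace E → ℝ≥0}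
    (hτ : IsHullStoppingTime τ) (u : ℝ≥0) :
    Measurable[IsStoppingTime.measurableSpace hτ] fun ω : PathSpace E => ω.1 (min u (τ ω)) := by
  have h : IsHullStoppingTime fun ω => min u (τ ω) := by
    simpa only [IsHullStoppingTime, WithTop.coe_min] using (isStoppingTime_const _ u).min hτ
  exact h.measurable_eval.mono (IsStoppingTime.measurableSpace_mono h hτ fun ω =>
    WithTop.coe_le_coe.2 (min_le_right _ _)) le_rfl

/-- The strong Markov property, as a formula for the joint law of the past and the future. -/
theorem IsStrongMarkovFamily.measure_inter {P : Kernel E (PathSpace E)} [IsMarkovKernel P]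
    (hP : IsStrongMarkovFamily P) {τ : PathSpace E → ℝ≥0} (hτ : IsHullStoppingTime τ)
    (hb : IsBoundedTime τ) (x : E) {A B : Set (PathSpace E)}
    (hA : MeasurableSet[IsStoppingTime.measurableSpace hτ] A) (hB : MeasurableSet B) :
    P x (A ∩ (fun ω => shiftPath (τ ω) ω) ⁻¹' B) = ∫⁻ ω in A, P (ω.1 (τ ω)) B ∂(P x) := by
  have hle := IsStoppingTime.measurableSpace_le hτ
  have hθ := measurable_shiftPath hτ.measurable
  have h := hP.strongMarkov τ hτ hb x (B.indicator 1) (measurable_one.indicator hB)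
    ⟨1, fun ω => by by_cases h : ω ∈ B <;> simp [h]⟩
  have hev : Measurable fun ω : PathSpace E => ω.1 (τ ω) := hτ.measurable_eval.mono hle le_rfl
  have h1 : (fun ω => (B.indicator 1 (shiftPath (τ ω) ω) : ℝ)) =
      ((fun ω => shiftPath (τ ω) ω) ⁻¹' B).indicator 1 := rfl
  have hint : Integrable (fun ω => (B.indicator 1 (shiftPath (τ ω) ω) : ℝ)) (P x) := by
    rw [h1]
    exact (integrable_const (1 : ℝ)).indicator (hθ hB)
  have h2 := setIntegral_condExp hle hint hA
  rw [setIntegral_congr_ae (hle A hA) (h.mono fun ω h _ => h), h1,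
    setIntegral_indicator (hθ hB)] at h2
  simp only [integral_indicator_one hB, Pi.one_apply, integral_const, smul_eq_mul, mul_one,
    measureReal_restrict_apply MeasurableSet.univ, univ_inter] at h2
  have h3 := integral_toReal (μ := (P x).restrict A)
    ((P.measurable_coe hB).comp hev).aemeasurable (.of_forall fun ω => measure_lt_top _ _)
  refine (ENNReal.toReal_eq_toReal_iff' (measure_ne_top _ _) ?_).1 (h2.symm.trans h3)
  refine ne_top_of_le_ne_top (measure_ne_top (P x) A) ?_
  refine (setLIntegral_mono measurable_const fun ω _ => prob_le_one).trans ?_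
  simp

/-- Every path is the concatenation at `τ` of itself with its own shift. -/
theorem IsStrongMarkovFamily.measure_eq_lintegral_concatPath {P : Kernel E (PathSpace E)}
    [IsMarkovKernel P]
    (hP : IsStrongMarkovFamily P) {τ : PathSpace E → ℝ≥0} (hτ : IsHullStoppingTime τ)
    (hb : IsBoundedTime τ) (x : E) {A : Set (PathSpace E)} (hA : MeasurableSet A) :
    P x A = ∫⁻ ω, P (ω.1 (τ ω)) {ω' | concatPath (τ ω) ω ω' ∈ A} ∂(P x) := by
  have hle := IsStoppingTime.measurableSpace_le hτ
  have hθ := measurable_shiftPath hτ.measurable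
  -- The part of the past that concatenation needs: the time, the stopped path and the current
  -- state. All are measurable at `τ`, so the strong Markov property gives the joint law of `f` and
  -- the shift.
  let f : PathSpace E → ℝ≥0 × (ℝ≥0 → E) × E := fun ω => (τ ω, fun u => ω.1 (min u (τ ω)), ω.1 (τ ω))
  have hfm : Measurable[IsStoppingTime.measurableSpace hτ] f :=
    hτ.measurable'.prodMk ((@measurable_pi_lambda _ _ _ (IsStoppingTime.measurableSpace hτ) _ _
      fun u => hτ.measurable_eval_min u).prodMk hτ.measurable_eval)
  have hf : Measurable f := hfm.mono hle le_rfl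
  let Φ : (ℝ≥0 × (ℝ≥0 → E) × E) × PathSpace E → ℝ≥0 → E := fun p u =>
    if u < p.1.1 then p.1.2.1 u else p.2.1 (u - p.1.1)
  have hΦ : Measurable Φ := by
    refine measurable_pi_lambda _ fun u => ?_
    refine Measurable.ite (measurableSet_lt measurable_const (by fun_prop)) (by fun_prop) ?_
    exact _root_.measurable_eval.comp
      ((measurable_const.sub (by fun_prop)).prodMk measurable_snd)
  have hΦf (ω ω' : PathSpace E) : Φ (f ω, ω') = (concatPath (τ ω) ω ω').1 := by
    ext u
    simp only [Φ, f, concatPath]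
    split_ifs with h
    · rw [min_eq_left h.le]
    · rfl
  let κ : Kernel (ℝ≥0 × (ℝ≥0 → E) × E) (PathSpace E) := P.comap (fun p => p.2.2) (by fun_prop)
  have hκ : IsMarkovKernel κ := by infer_instance
  have hlaw : (P x).map (fun ω => (f ω, shiftPath (τ ω) ω)) = ((P x).map f) ⊗ₘ κ := by
    have := Measure.isFiniteMeasure_map (P x) (fun ω => (f ω, shiftPath (τ ω) ω))
    have := Measure.isFiniteMeasure_map (P x) f
    refine Measure.ext_prod fun {S T} hS hT => ?_
    rw [Measure.map_apply (hf.prodMk hθ) (hS.prod hT), Measure.compProd_apply_prod hS hT,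
      setLIntegral_map hS (κ.measurable_coe hT) hf]
    exact hP.measure_inter hτ hb x (hfm hS) hT
  obtain ⟨A', hA', rfl⟩ := hA
  have h1 : P x (Subtype.val ⁻¹' A') =
      (P x).map (fun ω => (f ω, shiftPath (τ ω) ω)) (Φ ⁻¹' A') := by
    rw [Measure.map_apply (hf.prodMk hθ) (hΦ hA')]
    congr 1
    ext ω
    simp only [mem_preimage, hΦf, concatPath_shiftPath]
  have : IsFiniteMeasure ((P x).map f) := Measure.isFiniteMeasure_map (P x) f
  rw [h1, hlaw, Measure.compProd_apply (hΦ hA'),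
    lintegral_map (Kernel.measurable_kernel_prodMk_left (hΦ hA')) hf]
  refine lintegral_congr fun ω => ?_
  congr 1
  ext ω'
  simp only [mem_preimage, hΦf]
  rfl

end Concat

/-! ### Null sets of the concatenated law -/

section Equivalence

variable {E : Type*} [TopologicalSpace E] [MeasurableSpace E] [BorelSpace E]
  [TopologicalSpace.PseudoMetrizableSpace E] [SecondCountableTopology E]

/-- Concatenation with equivalent laws preserves equivalence with a strong Markov law. -/
theorem IsStrongMarkovFamily.map_compProd_eq_zero_iff {P : Kernel E (PathSpace E)}
    [IsMarkovKernel P] (hP : IsStrongMarkovFamily P) {τ : PathSpace E → ℝ≥0}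
    (hτ : IsHullStoppingTime τ) (hb : IsBoundedTime τ) {x : E} {Q : Measure (PathSpace E)}
    [IsProbabilityMeasure Q] (hQP : Q ≪ P x) (hPQ : P x ≪ Q)
    {κ : Kernel (PathSpace E) (PathSpace E)} [IsMarkovKernel κ]
    (hκ : ∀ᵐ ω ∂Q, κ ω ≪ P (ω.1 (τ ω)) ∧ P (ω.1 (τ ω)) ≪ κ ω) {A : Set (PathSpace E)}
    (hA : MeasurableSet A) :
    (Q ⊗ₘ κ).map (fun p => concatPath (τ p.1) p.1 p.2) A = 0 ↔ P x A = 0 := by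
  have hc := measurable_concatPath hτ.measurable
  have hev : Measurable fun ω : PathSpace E => ω.1 (τ ω) :=
    hτ.measurable_eval.mono (IsStoppingTime.measurableSpace_le hτ) le_rfl
  have hm (η : Kernel (PathSpace E) (PathSpace E)) [IsMarkovKernel η] :
      Measurable fun ω => η ω {ω' | concatPath (τ ω) ω ω' ∈ A} :=
    Kernel.measurable_kernel_prodMk_left (hc hA)
  rw [Measure.map_apply hc hA, Measure.compProd_apply (hc hA),
    hP.measure_eq_lintegral_concatPath hτ hb x hA]
  refine (lintegral_eq_zero_iff (hm κ)).trans
    (Iff.trans ?_ (lintegral_eq_zero_iff (hm (P.comap _ hev))).symm)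
  constructor
  · intro h
    refine hPQ.ae_le ?_
    filter_upwards [h, hκ] with ω h1 h2 using h2.2 h1
  · intro h
    filter_upwards [hQP.ae_le h, hκ] with ω h1 h2 using h2.1 h1

end Equivalence

/-! ### The martingale property of the concatenated law -/

section Concatenation

variable {d : ℕ} {F : Type*} [TopologicalSpace F]

open Classical in
theorem levelStopped_concatPath (n : ℕ) (t r : ℝ≥0) {ω ω' : PathSpace (MarketState d F)}
    (h : ω'.1 0 = ω.1 r) :
    levelStopped d F n t (concatPath r ω ω') = levelStopped d F n (min t r) ω +
      if r < levelTime d F n ω then levelStopped d F n (t - r) ω' - levelStopped d F n 0 ω'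
      else 0 := by
  have h1 : (fun t => priceProcess d F t (concatPath r ω ω')) = fun t =>
      if t < r then priceProcess d F t ω else priceProcess d F (t - r) ω' := by
    ext1 t
    simp only [priceProcess, concatPath]
    split_ifs <;> rfl
  have h2 : priceProcess d F 0 ω' = priceProcess d F r ω := by rw [priceProcess, h]; rfl
  rw [levelStopped, h1, reachStopped_paste (isRCLL_price ω) (isRCLL_price ω') h2]
  rfl

variable [MeasurableSpace F]

theorem IsHullStoppingTime.measurableSet_gt {E : Type*} [TopologicalSpace E] [MeasurableSpace E]
    {τ : PathSpace E → ℝ≥0} (hτ : IsHullStoppingTime τ) {s r : ℝ≥0} (hr : s < r) :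
    MeasurableSet[rawFiltration E r] {ω | s < τ ω} := by
  have hm := hτ s
  rw [hullFiltration, Filtration.rightCont_eq] at hm
  have h := (iInf₂_le (f := fun j (_ : j > s) => rawFiltration E j) r hr _ hm).compl
  convert! h using 1
  ext ω
  change s < τ ω ↔ ¬ (τ ω : WithTop ℝ≥0) ≤ s
  rw [WithTop.coe_le_coe, not_le]

variable [BorelSpace F] [TopologicalSpace.PseudoMetrizableSpace F] [SecondCountableTopology F]

/-- If the stopped price is a martingale under `Q`, and under `Q`-almost all continuation laws, with
a uniform `L¹`-bound, then it is a martingale under the concatenation. -/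
theorem martingale_levelStopped_concat {Q : Measure (PathSpace (MarketState d F))}
    [IsProbabilityMeasure Q]
    {κ : Kernel (PathSpace (MarketState d F)) (PathSpace (MarketState d F))} [IsMarkovKernel κ]
    {τ : PathSpace (MarketState d F) → ℝ≥0} (hτ : IsHullStoppingTime τ) {n : ℕ} {i : Fin d} {C : ℝ}
    (hQ : Martingale (fun t ω => levelStopped d F n t ω i) (rawFiltration (MarketState d F)) Q)
    (hκ : ∀ᵐ ω ∂Q, (∀ᵐ ω' ∂(κ ω), ω'.1 0 = ω.1 (τ ω)) ∧
      Martingale (fun t ω => levelStopped d F n t ω i) (rawFiltration (MarketState d F)) (κ ω) ∧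
      ∀ t, ∫ ω', |levelStopped d F n t ω' i| ∂(κ ω) ≤ C) :
    Martingale (fun t ω => levelStopped d F n t ω i) (rawFiltration (MarketState d F))
      ((Q ⊗ₘ κ).map fun p => concatPath (τ p.1) p.1 p.2) := by
  classical
  set 𝓕 := rawFiltration (MarketState d F)
  set c : PathSpace (MarketState d F) × PathSpace (MarketState d F) → PathSpace (MarketState d F) :=
    fun p => concatPath (τ p.1) p.1 p.2 with hcdef
  have hc : Measurable c := measurable_concatPath hτ.measurable
  set Y : ℝ≥0 → PathSpace (MarketState d F) → ℝ := fun t ω => levelStopped d F n t ω i with hY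
  have hYa (t : ℝ≥0) : StronglyMeasurable[𝓕 t] (Y t) := hQ.stronglyMeasurable t
  have hYm (t : ℝ≥0) : StronglyMeasurable (Y t) := (hYa t).mono (𝓕.le t)
  have hYc (ω) (t : ℝ≥0) : ContinuousWithinAt (fun s => Y s ω) (Ici t) t := by
    have hc : Continuous fun v : EuclideanSpace ℝ (Fin d) => v i := by fun_prop
    exact hc.continuousAt.comp_continuousWithinAt
      (continuousWithinAt_reachStopped (fun u => (isRCLL_price ω u).1) t)
  have hconc (t r : ℝ≥0) {ω ω' : PathSpace (MarketState d F)} (h : ω'.1 0 = ω.1 r) :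
      Y t (concatPath r ω ω') = Y (min t r) ω +
        if r < levelTime d F n ω then Y (t - r) ω' - Y 0 ω' else 0 := by
    simp only [hY, levelStopped_concatPath n t r h]
    split_ifs <;> simp
  have hosQ (t : ℝ≥0) := hQ.optional_stopping hYc hτ.measurableSet_lt t
  have hYcm (t : ℝ≥0) : StronglyMeasurable fun p => Y t (c p) := (hYm t).comp_measurable hc
  have hYi (t : ℝ≥0) : Integrable (fun p => Y t (c p)) (Q ⊗ₘ κ) := by
    refine (Measure.integrable_compProd_iff (hYcm t).aestronglyMeasurable).2 ⟨?_, ?_⟩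
    · filter_upwards [hκ] with ω ⟨h0, hM, _⟩
      have hg : Integrable (fun ω' => Y (min t (τ ω)) ω +
          if τ ω < levelTime d F n ω then Y (t - τ ω) ω' - Y 0 ω' else 0) (κ ω) := by
        refine (integrable_const _).add ?_
        split_ifs
        · exact (hM.integrable _).sub (hM.integrable _)
        · exact integrable_zero _ _ _
      exact hg.congr (h0.mono fun ω' h => (hconc t (τ ω) h).symm)
    -- The constant `C`, uniform in the continuation law, is used once for time `t - τ` and once for
    -- time `0`.
    · refine Integrable.mono' (g := fun ω => |Y (min (τ ω) t) ω| + (C + C))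
        ((hosQ t).1.abs.add (integrable_const _))
        ((hYcm t).norm.integral_kernel_prod_right').aestronglyMeasurable ?_
      filter_upwards [hκ] with ω ⟨h0, hM, hC⟩
      rw [Real.norm_of_nonneg (integral_nonneg fun _ => norm_nonneg _)]
      have hi (t : ℝ≥0) : Integrable (fun ω' => |Y t ω'|) (κ ω) := (hM.integrable t).abs
      have hi2 : Integrable (fun ω' => |Y (t - τ ω) ω'| + |Y 0 ω'|) (κ ω) := (hi _).add (hi _)
      calc ∫ ω', ‖Y t (c (ω, ω'))‖ ∂(κ ω)
          ≤ ∫ ω', (|Y (min (τ ω) t) ω| + (|Y (t - τ ω) ω'| + |Y 0 ω'|)) ∂(κ ω) := by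
            refine integral_mono_of_nonneg (.of_forall fun _ => norm_nonneg _)
              ((integrable_const _).add hi2) ?_
            filter_upwards [h0] with ω' h
            change |Y t (concatPath (τ ω) ω ω')| ≤ _
            rw [hconc t (τ ω) h, min_comm]
            refine (abs_add_le _ _).trans (add_le_add_right ?_ _)
            split_ifs
            · exact abs_sub _ _
            · simp only [abs_zero]
              positivity
        _ ≤ |Y (min (τ ω) t) ω| + (C + C) := by
            rw [integral_add (integrable_const _) hi2, integral_add (hi _) (hi _)]
            simp only [integral_const, probReal_univ, one_smul]
            gcongr
            exacts [hC _, hC _]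
  refine martingale_of_setIntegral_eq hYa (fun t => ?_) fun s t hst A hA => ?_
  · exact (integrable_map_measure (hYm t).aestronglyMeasurable hc.aemeasurable).2 (hYi t)
  have hA' := 𝓕.le s A hA
  have hD : Integrable ((c ⁻¹' A).indicator fun p => Y t (c p) - Y s (c p)) (Q ⊗ₘ κ) :=
    ((hYi t).sub (hYi s)).indicator (hc hA')
  rw [setIntegral_map hA' (hYm s).aestronglyMeasurable hc.aemeasurable,
    setIntegral_map hA' (hYm t).aestronglyMeasurable hc.aemeasurable, eq_comm, ← sub_eq_zero,
    ← integral_sub (hYi t).integrableOn (hYi s).integrableOn, ← integral_indicator (hc hA'),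
    Measure.integral_compProd hD]
  -- Only the paths with `τ > s` survive the inner integration. As `τ` is a hull stopping time, `B`
  -- is only known to lie in the σ-algebras of times after `s`.
  set B : Set (PathSpace (MarketState d F)) := A ∩ {ω | s < τ ω} with hB
  have hBm (r : ℝ≥0) (hr : r > s) : MeasurableSet[𝓕 r] B :=
    (𝓕.mono hr.le A hA).inter (hτ.measurableSet_gt hr)
  have hinner : ∀ᵐ ω ∂Q, ∫ ω', (c ⁻¹' A).indicator (fun p => Y t (c p) - Y s (c p)) (ω, ω') ∂(κ ω) =
      B.indicator (fun ω => Y (min (τ ω) t) ω - Y s ω) ω := by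
    filter_upwards [hκ] with ω ⟨h0, hM, _⟩
    have hpt : ∀ᵐ ω' ∂(κ ω), (c ⁻¹' A).indicator (fun p => Y t (c p) - Y s (c p)) (ω, ω') =
        if concatPath (τ ω) ω ω' ∈ A then Y (min t (τ ω)) ω - Y (min s (τ ω)) ω +
          if τ ω < levelTime d F n ω then Y (t - τ ω) ω' - Y (s - τ ω) ω' else 0 else 0 := by
      filter_upwards [h0] with ω' h
      simp only [indicator_apply, mem_preimage, hcdef, hconc _ _ h]
      split_ifs <;> ring
    rw [integral_congr_ae hpt]
    rcases lt_or_ge s (τ ω) with hs | hs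
    · have hmem (ω') : concatPath (τ ω) ω ω' ∈ A ↔ ω ∈ A := concatPath_mem_iff_of_lt hs hA ω ω'
      have hωB : ω ∈ B ↔ ω ∈ A := and_iff_left hs
      simp only [hmem, indicator_apply, hωB, min_eq_left hs.le, tsub_eq_zero_of_le hs.le, min_comm t]
      split_ifs
      · have hi : Integrable (fun ω' => Y (t - τ ω) ω' - Y 0 ω') (κ ω) :=
          (hM.integrable _).sub (hM.integrable _)
        rw [integral_add (integrable_const _) hi, integral_sub (hM.integrable _) (hM.integrable _)]
        have := hM.setIntegral_eq (zero_le (a := t - τ ω)) MeasurableSet.univ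
        simp only [setIntegral_univ] at this
        simp [this]
      · simp
      · simp
    · have hωB : ω ∉ B := fun h => absurd h.2 (not_lt.2 hs)
      rw [indicator_of_notMem hωB]
      simp only [min_eq_right hs, min_eq_right (hs.trans hst.le), sub_self, zero_add]
      by_cases hl : τ ω < levelTime d F n ω
      · have hA2 : MeasurableSet[𝓕 (s - τ ω)] (concatPath (τ ω) ω ⁻¹' A) :=
          measurable_concatPath_rawFiltration ω hA
        have h1 := hM.setIntegral_eq (tsub_le_tsub_right hst.le (τ ω)) hA2
        have h2 : (fun ω' => if concatPath (τ ω) ω ω' ∈ A then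
            if τ ω < levelTime d F n ω then Y (t - τ ω) ω' - Y (s - τ ω) ω' else 0 else 0) =
            (concatPath (τ ω) ω ⁻¹' A).indicator
              fun ω' => Y (t - τ ω) ω' - Y (s - τ ω) ω' := by
          ext ω'
          simp only [indicator_apply, mem_preimage, if_pos hl]
        rw [h2, integral_indicator (𝓕.le _ _ hA2), integral_sub (hM.integrable _).integrableOn
          (hM.integrable _).integrableOn, h1, sub_self]
      · simp only [if_neg hl, ite_self, integral_zero]
  rw [integral_congr_ae hinner, integral_indicator (𝓕.le t _ (hBm t hst)),
    integral_sub (hosQ t).1.integrableOn (hQ.integrable s).integrableOn,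
    (hosQ t).2 s hst B hBm fun ω hω => hω.2.le, sub_eq_zero]
  -- Optional stopping at the constant time `s` extends the martingale identity between `s` and `t`
  -- to the event `B`.
  have h := (hQ.optional_stopping hYc (τ := fun _ => s) (fun u => MeasurableSet.const _) t).2 s hst B
    hBm fun ω _ => le_rfl
  simpa only [min_eq_left hst.le] using h.symm

end Concatenation

theorem martingale_of_coord {d : ℕ} {Ω : Type*} {mΩ : MeasurableSpace Ω} {μ : Measure Ω}
    [IsFiniteMeasure μ] {𝓕 : Filtration ℝ≥0 mΩ} {M : ℝ≥0 → Ω → EuclideanSpace ℝ (Fin d)}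
    (ha : StronglyAdapted 𝓕 M) (hM : ∀ i, Martingale (fun t ω => M t ω i) 𝓕 μ) :
    Martingale M 𝓕 μ := by
  have hi (t : ℝ≥0) : Integrable (M t) μ := Integrable.of_eval_piLp fun i => (hM i).integrable t
  refine martingale_of_setIntegral_eq ha hi fun s t hst A hA => ?_
  ext i
  rw [eval_integral_piLp fun j => ((hi s).eval_piLp j).integrableOn,
    eval_integral_piLp fun j => ((hi t).eval_piLp j).integrableOn]
  exact (hM i).setIntegral_eq hst.le hA

/-! ### A common localizing sequence and a uniform bound -/

section Selectors

variable {d : ℕ} {F : Type*} [TopologicalSpace F]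

theorem isLocalizingSequence_levelTime [MeasurableSpace F]
    (μ : Measure (PathSpace (MarketState d F))) :
    IsLocalizingSequence (rawFiltration (MarketState d F)) (levelTime d F) μ where
  isStoppingTime := isStoppingTime_levelTime
  tendsto_top := .of_forall fun ω => (isRCLL_price ω).tendsto_reachTime
  mono := .of_forall fun ω _ _ h =>
    monotone_reachTime (fun t => (isRCLL_price ω t).1) (Nat.cast_le.2 h)

/-- The martingale property of the stopped price, with an `L¹`-bound that is uniform in the state
and in the local martingale measure. -/
theorem UniformlyLocallyBoundedBelow.exists_martingale_levelStopped [MeasurableSpace F]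
    {P : Kernel (MarketState d F) (PathSpace (MarketState d F))}
    (hP : UniformlyLocallyBoundedBelow P) (n : ℕ) :
    ∃ C : ℝ, ∀ x, ∀ Q ∈ localMartingaleMeasures P x, ∀ i,
      Martingale (fun t ω => levelStopped d F n t ω i) (rawFiltration (MarketState d F)) Q ∧
        ∀ t, ∫ ω, |levelStopped d F n t ω i| ∂Q ≤ C := by
  obtain ⟨a, ha⟩ := hP n
  refine ⟨n + 2 * |a|, fun x Q ⟨hQ, ⟨hQP, _⟩, hloc⟩ i => martingale_levelStopped hloc ?_ i⟩
  filter_upwards [hQP.ae_le (ha x)] with ω hω hpos t ht i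
  have hle := levelTime_le_exitTime n ω
  have h := hω (hpos.trans_le hle) t i
  change a ≤ priceProcess d F (truncTime (exitTime d F n ω) t) ω i at h
  rwa [truncTime_eq_self (ht.trans hle)] at h

end Selectors

theorem mainTheorem6 {d : ℕ} {F : Type*} [TopologicalSpace F] [LocallyCompactSpace F] [T2Space F]
    [SecondCountableTopology F] [MeasurableSpace F] [BorelSpace F]
    (P : Kernel (MarketState d F) (PathSpace (MarketState d F))) [IsMarkovKernel P]
    (hMarkov : IsStrongMarkovFamily P)
    (hHorizon : HasFiniteHorizon P)
    (hNFLVR : ∀ x, (localMartingaleMeasures P x).Nonempty)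
    (hBounded : UniformlyLocallyBoundedBelow P)
    (x : MarketState d F) (Q : Measure (PathSpace (MarketState d F)))
    (hQ : Q ∈ localMartingaleMeasures P x)
    (τ : PathSpace (MarketState d F) → ℝ≥0) (hτ : IsHullStoppingTime τ) (hτb : IsBoundedTime τ)
    (ν : MarketState d F → Measure (PathSpace (MarketState d F)))
    (hν : IsSelector (localMartingaleMeasures P) ν) :
    concatLaw Q τ ν ∈ localMartingaleMeasures P x := by
  have := TopologicalSpace.metrizableSpace_of_t3_secondCountable F
  have hQ1 : IsProbabilityMeasure Q := hQ.1
  have hev : Measurable fun ω : PathSpace (MarketState d F) => ω.1 (τ ω) :=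
    hτ.measurable_eval.mono (IsStoppingTime.measurableSpace_le hτ) le_rfl
  have : IsProbabilityMeasure (Q.map fun ω => ω.1 (τ ω)) :=
    Measure.isProbabilityMeasure_map hev.aemeasurable
  -- The concatenation sees `ν` only through the law of `X_τ` under `Q`, so a Borel modification for
  -- that law suffices.
  obtain ⟨κ₀, hκ₀, hκν⟩ := hν.isUniversalKernel.exists_kernel (Q.map fun ω => ω.1 (τ ω))
  let κ : Kernel (PathSpace (MarketState d F)) (PathSpace (MarketState d F)) := κ₀.comap _ hev
  have hκ : ∀ᵐ ω ∂Q, κ ω = ν (ω.1 (τ ω)) := ae_of_ae_map hev.aemeasurable hκν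
  have hc := measurable_concatPath hτ.measurable
  have hae : ∀ᵐ ω ∂Q, κ ω ≪ P (ω.1 (τ ω)) ∧ P (ω.1 (τ ω)) ≪ κ ω := by
    filter_upwards [hκ] with ω hω
    rw [hω]
    exact (hν.mem _).2.1
  -- The laws `P y` start at `y`, and the continuation laws inherit this by absolute continuity;
  -- this is the fit `ω'(0) = ω(τ)` required for pasting.
  have hstart : ∀ᵐ ω ∂Q, ∀ᵐ ω' ∂(κ ω), ω'.1 0 = ω.1 (τ ω) := by
    filter_upwards [hae] with ω hω
    exact hω.1.ae_le ((prob_compl_eq_zero_iff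
      ((measurable_coord 0) (measurableSet_singleton _))).2 (hMarkov.start _))
  rw [concatLaw_eq_map_compProd hκ]
  have hzero {A : Set (PathSpace (MarketState d F))} (hA : MeasurableSet A) :=
    hMarkov.map_compProd_eq_zero_iff hτ hτb hQ.2.1.1 hQ.2.1.2 hae hA
  have hprob : IsProbabilityMeasure ((Q ⊗ₘ κ).map fun p => concatPath (τ p.1) p.1 p.2) :=
    Measure.isProbabilityMeasure_map hc.aemeasurable
  refine ⟨hprob, ⟨.mk fun A hA h => (hzero hA).2 h, .mk fun A hA h => (hzero hA).1 h⟩,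
    levelTime d F, isLocalizingSequence_levelTime _, fun n => ?_⟩
  rw [stoppedProcess_levelTime]
  obtain ⟨C, hC⟩ := hBounded.exists_martingale_levelStopped n
  refine martingale_of_coord (stronglyMeasurable_levelStopped n) fun i => ?_
  refine martingale_levelStopped_concat hτ (hC x Q hQ i).1 (C := C) ?_
  filter_upwards [hκ, hstart] with ω h1 h2
  refine ⟨h2, ?_⟩
  rw [h1]
  exact hC _ _ (hν.mem _) i
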